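/- Let $d,r\ge 1$ be integers. A matrix $B\in\mathbb R^{d\times d}$ is called a Frolov matrix if (a) $B$ is invertible, (b) $\bigl|\prod_{j=1}^d (Bm)_j\bigr|\ge 1$ for every $m\in\mathbb Z^d\setminus\{0\}$, and (c) for all $x,y\in\mathbb R^d$ the box $\{z\in\mathbb R^d : z_j \text{ lies between } x_j \text{ and } y_j \text{ for } j=1,\dots,d\}$ contains at most $\prod_{j=1}^d|x_j-y_j|+1$ of the points $Bm$, $m\in\mathbb Z^d$. For an invertible matrix $S\in\mathbb R^{d\times d}$, $v\in\mathbb R^d$ and a compactly supported $f:\mathbb R^d\to\mathbb R$ put $$Q_S^v(f)=\frac1{|\det S|}\sum_{m\in\mathbb Z^d} f\bigl(S^{-\top}(m+v)\bigr),\qquad I_d(f)=\int_{\mathbb R^d}f(x)\,dx .$$ Let $\mathring H^{r,\mathrm{mix}}([0,1]^d)$ be the space of continuous functions $f:\mathbb R^d\to\mathbb R$ with support contained in $[0,1]^d$ such that the weak derivative $D^\alpha f$ exists and lies in $L^2(\mathbb R^d)$ for every $\alpha\in\{0,\dots,r\}^d$, and let $$\|f\|_{H^{r,\mathrm{mix}}([0,1]^d)}=\Bigl(\sum_{\alpha\in\{0,\dots,r\}^d}\|D^\alpha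 f\|_{L^2([0,1]^d)}^2\Bigr)^{1/2}.$$ **Theorem.** Let $B\in\mathbb R^{d\times d}$ be a Frolov matrix, let $U$ be a random vector uniformly distributed in $[1,2^{1/d}]^d$, and let $\hat U=\operatorname{diag}(U_1,\dots,U_d)$. There is a constant $c>0$, depending only on $d$, $r$ and $B$, such that for every integer $n\ge 2$, every shift parameter $v\in\mathbb R^d$ and every $f\in\mathring H^{r,\mathrm{mix}}([0,1]^d)$ the error $|Q^v_{n^{1/d}\hat UB}(f)-I_d(f)|$ is integrable and $$\mathbb E\,\bigl|Q^v_{n^{1/d}\hat UB}(f)-I_d(f)\bigr|\le c\,n^{-r-1/2}(\log n)^{(d-1)/2}\,\|f\|_{H^{r,\mathrm{mix}}([0,1]^d)} .$$ -/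

import Mathlib

open MeasureTheory ProbabilityTheory
open scoped ContDiff Matrix

noncomputable section

/-- The partial derivative `∂_i φ` of a real function on `ℝ^d`. -/
def partialDeriv {d : ℕ} (i : Fin d) (φ : EuclideanSpace ℝ (Fin d) → ℝ) :
    EuclideanSpace ℝ (Fin d) → ℝ :=
  fun x => fderiv ℝ φ x (EuclideanSpace.single i 1)

/-- The classical derivative `D^α φ = ∂_0^{α_0} ⋯ ∂_{d-1}^{α_{d-1}} φ`. -/
def multiDeriv {d : ℕ} (α : Fin d → ℕ) (φ : EuclideanSpace ℝ (Fin d) → ℝ) :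
    EuclideanSpace ℝ (Fin d) → ℝ :=
  (List.finRange d).foldr (fun i ψ => (partialDeriv i)^[α i] ψ) φ

/-- `g` is a weak derivative `D^α f` of `f` on the open set `Ω`. -/
def HasWeakDerivOn {d : ℕ} (Ω : Set (EuclideanSpace ℝ (Fin d))) (α : Fin d → ℕ)
    (f g : EuclideanSpace ℝ (Fin d) → ℝ) : Prop :=
  LocallyIntegrableOn f Ω ∧ LocallyIntegrableOn g Ω ∧
    ∀ φ : EuclideanSpace ℝ (Fin d) → ℝ,
      ContDiff ℝ ∞ φ → HasCompactSupport φ → tsupport φ ⊆ Ω →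
        ∫ x in Ω, f x * multiDeriv α φ x = (-1) ^ (∑ i, α i) * ∫ x in Ω, g x * φ x

open Classical in
/-- The weak derivative `D^α f` on `Ω` (unique up to null sets in `Ω`); `0` if there is none. -/
def weakDeriv {d : ℕ} (Ω : Set (EuclideanSpace ℝ (Fin d))) (α : Fin d → ℕ)
    (f : EuclideanSpace ℝ (Fin d) → ℝ) : EuclideanSpace ℝ (Fin d) → ℝ :=
  if h : ∃ g, HasWeakDerivOn Ω α f g then h.choose else 0

/-- `f ∈ H^{r,mix}(Ω)`: `f` and its weak derivatives `D^α f`, `α ∈ {0,…,r}^d`, are in `L²(Ω)`. -/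
def MemHMix {d : ℕ} (r : ℕ) (Ω : Set (EuclideanSpace ℝ (Fin d)))
    (f : EuclideanSpace ℝ (Fin d) → ℝ) : Prop :=
  MemLp f 2 (volume.restrict Ω) ∧
    ∀ α : Fin d → ℕ, (∀ i, α i ≤ r) →
      ∃ g, HasWeakDerivOn Ω α f g ∧ MemLp g 2 (volume.restrict Ω)

/-- The norm `(∑_{α ∈ {0,…,r}^d} ‖D^α f‖²_{L²(Ω)})^{1/2}` of `H^{r,mix}(Ω)`. -/
def normHMix {d : ℕ} (r : ℕ) (Ω : Set (EuclideanSpace ℝ (Fin d)))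
    (f : EuclideanSpace ℝ (Fin d) → ℝ) : ℝ :=
  Real.sqrt (∑ α ∈ Fintype.piFinset (fun _ : Fin d => Finset.range (r + 1)),
    ∫ x in Ω, (weakDeriv Ω α f x) ^ 2)

/-- The closed unit cube `[0,1]^d`. -/
def unitCube (d : ℕ) : Set (EuclideanSpace ℝ (Fin d)) :=
  {x | ∀ i, x i ∈ Set.Icc (0 : ℝ) 1}

/-- The open unit cube `(0,1)^d`. The norm of `H^{r,mix}([0,1]^d)` is the one over this open set,
the boundary of the cube being a null set. -/
def openUnitCube (d : ℕ) : Set (EuclideanSpace ℝ (Fin d)) :=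
  {x | ∀ i, x i ∈ Set.Ioo (0 : ℝ) 1}

/-- The space of functions in `H^{r,mix}(ℝ^d)` with support in `[0,1]^d`; as usual for `r ≥ 1`,
the elements are taken to be continuous functions. -/
structure MemHMixZero {d : ℕ} (r : ℕ) (f : EuclideanSpace ℝ (Fin d) → ℝ) : Prop where
  continuous : Continuous f
  memHMix : MemHMix r Set.univ f
  tsupport_subset : tsupport f ⊆ unitCube d

/-- Frolov matrices. -/
structure IsFrolovMatrix {d : ℕ} (B : Matrix (Fin d) (Fin d) ℝ) : Prop where
  invertible : IsUnit B
  one_le_prod : ∀ m : Fin d → ℤ, m ≠ 0 → 1 ≤ |∏ j, (B *ᵥ (fun i => (m i : ℝ))) j|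
  box_count : ∀ x y : Fin d → ℝ,
    {m : Fin d → ℤ | ∀ j, (B *ᵥ (fun i => (m i : ℝ))) j ∈ Set.uIcc (x j) (y j)}.Finite ∧
    ({m : Fin d → ℤ | ∀ j, (B *ᵥ (fun i => (m i : ℝ))) j ∈ Set.uIcc (x j) (y j)}.ncard : ℝ)
      ≤ ∏ j, |x j - y j| + 1

/-- The quadrature rule `Q_S^v(f) = |det S|⁻¹ ∑_{m ∈ ℤ^d} f (S^{-⊤} (m + v))`. -/
def latticeRule {d : ℕ} (S : Matrix (Fin d) (Fin d) ℝ) (v : Fin d → ℝ)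
    (f : EuclideanSpace ℝ (Fin d) → ℝ) : ℝ :=
  |S.det|⁻¹ * ∑' m : Fin d → ℤ, f (WithLp.toLp 2 ((S⁻¹)ᵀ *ᵥ (fun i => (m i : ℝ) + v i)))

/-- The dilated matrix `n^{1/d} diag(u) B`. -/
def dilatedMatrix {d : ℕ} (n : ℕ) (u : Fin d → ℝ) (B : Matrix (Fin d) (Fin d) ℝ) :
    Matrix (Fin d) (Fin d) ℝ :=
  ((n : ℝ) ^ (1 / (d : ℝ))) • (Matrix.diagonal u * B)

/-- The box `[1, 2^{1/d}]^d` of dilation parameters. -/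
def dilationBox (d : ℕ) : Set (Fin d → ℝ) :=
  {u | ∀ i, u i ∈ Set.Icc (1 : ℝ) (2 ^ (1 / (d : ℝ)))}

end

/-! Write ν = n^{1/d}. Poisson summation (`hasSum_poisson_summation`) bounds the error of the
lattice rule by the sum of |f̂(ν u·Bk)| over k ≠ 0, whatever the shift v
(`enorm_latticeRule_sub_integral_le`). Averaging over u turns each term into an integral of |f̂|
over the box of points ν Bk·u, weighted by 1/|∏ (ν Bk)_i|. A point x in such boxes has |∏ x_i| ≥ n
by the product condition. By the box count it lies in at most 2|∏ x_i|/n of them, each of weight at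
most 2/|∏ x_i|. So the sum is at most (4/n) ∫ |f̂| over ∏ max(1,|x_i|) ≥ n
(`IsFrolovMatrix.tsum_lintegral_dilationBox_le`). Cauchy–Schwarz with the weight (∏ max(1,|x_i|))^r
leaves two factors. One is bounded by the Sobolev norm
(`MemHMixZero.lintegral_maxProd_euclFourier_le`). The other is the root of a tail integral of order
n^{1-2r} (log n)^{d-1} (`exists_crossTail_le`). The exponents add up: n^{-1} · n^{1/2-r} =
n^{-r-1/2}. -/

/-! ### Tiling of ℝ^d by integer translates of the unit cube. -/

/-- The real vector with the integer coordinates `k`. -/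
def intVec {d : ℕ} (k : Fin d → ℤ) : Fin d → ℝ := fun i => (k i : ℝ)

/-- The half-open cube `(0,1]^d`. -/
def iocCube (d : ℕ) : Set (Fin d → ℝ) := {x | ∀ i, x i ∈ Set.Ioc (0 : ℝ) 1}

lemma measurableSet_iocCube (d : ℕ) : MeasurableSet (iocCube d) :=
  MeasurableSet.univ_pi' fun _ => measurableSet_Ioc

lemma volume_iocCube (d : ℕ) : volume (iocCube d) = 1 := by
  have : iocCube d = Set.univ.pi fun _ => Set.Ioc (0 : ℝ) 1 := by
    ext x; simp [iocCube]
  rw [this, volume_pi_pi]; simp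

/-- The half-open cubes k + (0,1]^d tile the space. As an identity of measures it yields both the
Lebesgue and the Bochner decomposition of an integral. -/
lemma sum_map_restrict_iocCube (d : ℕ) :
    Measure.sum (fun k : Fin d → ℤ => (volume.restrict (iocCube d)).map (· + intVec k)) =
      volume := by
  set Q : (Fin d → ℤ) → Set (Fin d → ℝ) :=
    fun k => {x | ∀ i, x i ∈ Set.Ioc (k i : ℝ) (k i + 1)} with hQ
  have hQm : ∀ k, MeasurableSet (Q k) := fun k =>
    MeasurableSet.univ_pi' fun _ => measurableSet_Ioc
  have hU : ⋃ k, Q k = Set.univ := by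
    refine Set.eq_univ_of_forall fun x => Set.mem_iUnion.2 ⟨fun i => ⌈x i⌉ - 1, fun i => ?_⟩
    have h1 := Int.ceil_lt_add_one (x i)
    have h2 := Int.le_ceil (x i)
    push_cast
    constructor <;> linarith
  have hD : Pairwise (Function.onFun Disjoint Q) := by
    intro k l hkl
    refine Set.disjoint_left.2 fun x hx hy => hkl (funext fun i => ?_)
    have h1 := hx i
    have h2 := hy i
    have h3 : (k i : ℝ) < l i + 1 := h1.1.trans_le h2.2
    have h4 : (l i : ℝ) < k i + 1 := h2.1.trans_le h1.2
    norm_cast at h3 h4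
    omega
  have hk : ∀ k, (volume.restrict (iocCube d)).map (· + intVec k) = volume.restrict (Q k) := by
    intro k
    have h := (measurePreserving_add_right (volume : Measure (Fin d → ℝ)) (intVec k)).restrict_preimage
      (hQm k)
    have h' : (· + intVec k) ⁻¹' (Q k) = iocCube d := by
      ext x
      simp only [hQ, iocCube, intVec, Set.mem_preimage, Set.mem_ofPred_eq, Set.mem_Ioc, Pi.add_apply]
      refine forall_congr' fun i => ?_
      constructor <;> rintro ⟨h1, h2⟩ <;> constructor <;> linarith
    rw [h'] at h
    exact h.map_eq
  simp_rw [hk]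
  rw [← Measure.restrict_iUnion hD hQm, hU, Measure.restrict_univ]

lemma lintegral_eq_tsum_iocCube {d : ℕ} {F : (Fin d → ℝ) → ENNReal} (hF : Measurable F) :
    ∫⁻ x, F x = ∑' k : Fin d → ℤ, ∫⁻ x in iocCube d, F (x + intVec k) := by
  conv_lhs => rw [← sum_map_restrict_iocCube d, lintegral_sum_measure]
  refine tsum_congr fun k => ?_
  rw [lintegral_map hF (measurable_add_const _)]

lemma hasSum_integral_iocCube {d : ℕ} {F : (Fin d → ℝ) → ℂ} (hF : Integrable F) :
    HasSum (fun k : Fin d → ℤ => ∫ x in iocCube d, F (x + intVec k)) (∫ x, F x) := by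
  have h := hF
  rw [← sum_map_restrict_iocCube d] at h
  have := hasSum_integral_measure h
  rw [sum_map_restrict_iocCube d] at this
  convert! this using 2 with k
  rw [(measurableEmbedding_addRight (intVec k)).integral_map]

/-! ### Characters, the Fourier transform and Fourier coefficients on the torus. -/

/-- The character `t ↦ exp (2 π i t)` of the real line. -/
noncomputable def phase (t : ℝ) : ℂ := Real.fourierChar t

lemma phase_eq_exp (t : ℝ) : phase t = Complex.exp ((2 * Real.pi * t : ℝ) * Complex.I) :=
  Real.fourierChar_apply t

lemma norm_phase (t : ℝ) : ‖phase t‖ = 1 := Circle.norm_coe _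

lemma phase_add (s t : ℝ) : phase (s + t) = phase s * phase t := by
  simp [phase, AddChar.map_add_eq_mul]

lemma phase_intCast (k : ℤ) : phase (k : ℝ) = 1 := by
  rw [phase_eq_exp, show (((2 * Real.pi * (k : ℝ) : ℝ)) : ℂ) * Complex.I =
    k * (2 * Real.pi * Complex.I) by push_cast; ring]
  exact Complex.exp_int_mul_two_pi_mul_I k

lemma continuous_phase : Continuous phase :=
  continuous_subtype_val.comp Real.continuous_fourierChar

/-- The Fourier transform of a function on `ℝ^d`. -/
noncomputable def piFourier {d : ℕ} (g : (Fin d → ℝ) → ℂ) (ξ : Fin d → ℝ) : ℂ :=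
  ∫ x, phase (-(x ⬝ᵥ ξ)) * g x

lemma continuous_phase_dotProduct {d : ℕ} :
    Continuous fun p : (Fin d → ℝ) × (Fin d → ℝ) => phase (-(p.1 ⬝ᵥ p.2)) := by
  refine continuous_phase.comp ?_
  unfold dotProduct
  fun_prop

lemma continuous_piFourier {d : ℕ} {g : (Fin d → ℝ) → ℂ} (hg : Integrable g) :
    Continuous (piFourier g) := by
  refine continuous_of_dominated (bound := fun x => ‖g x‖) (fun ξ => ?_) (fun ξ => ?_) hg.norm ?_
  · refine AEStronglyMeasurable.mul ?_ hg.1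
    exact (continuous_phase_dotProduct.comp (by fun_prop :
      Continuous fun x : Fin d → ℝ => (x, ξ))).aestronglyMeasurable
  · refine Filter.Eventually.of_forall fun x => ?_
    simp [norm_phase]
  · refine Filter.Eventually.of_forall fun x => ?_
    exact (continuous_phase_dotProduct.comp (by fun_prop :
      Continuous fun ξ : Fin d → ℝ => (x, ξ))).mul continuous_const

lemma mFourier_apply_coe {d : ℕ} (k : Fin d → ℤ) (x : Fin d → ℝ) :
    UnitAddTorus.mFourier k (fun i => (x i : UnitAddCircle)) = phase (x ⬝ᵥ intVec k) := by
  simp only [UnitAddTorus.mFourier, ContinuousMap.coe_mk, fourier_coe_apply]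
  rw [← Complex.exp_sum, phase_eq_exp]
  congr 1
  simp only [dotProduct, intVec, Complex.ofReal_mul, Complex.ofReal_sum, Finset.mul_sum,
    Finset.sum_mul]
  refine Finset.sum_congr rfl fun i _ => ?_
  push_cast
  ring

lemma mFourierCoeff_eq_iocCube {d : ℕ} (G : UnitAddTorus (Fin d) → ℂ) (k : Fin d → ℤ) :
    UnitAddTorus.mFourierCoeff G k = ∫ x in iocCube d,
      phase (-(x ⬝ᵥ intVec k)) * G (fun i => (x i : UnitAddCircle)) := by
  rw [UnitAddTorus.mFourierCoeff_eq_integral G k 0]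
  have : {x : Fin d → ℝ | ∀ i, x i ∈ Set.Ioc ((0 : Fin d → ℝ) i) ((0 : Fin d → ℝ) i + 1)} =
      iocCube d := by simp [iocCube]
  rw [this]
  refine integral_congr_ae (Filter.Eventually.of_forall fun x => ?_)
  simp only [smul_eq_mul]
  rw [mFourier_apply_coe]
  congr 3
  simp [intVec, dotProduct]

/-! ### Periodization and Poisson summation. -/

/-- The covering map of the torus. -/
def torusMk {d : ℕ} (x : Fin d → ℝ) : UnitAddTorus (Fin d) := fun i => (x i : UnitAddCircle)

lemma isOpenQuotientMap_torusMk {d : ℕ} : IsOpenQuotientMap (torusMk (d := d)) :=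
  IsOpenQuotientMap.piMap fun _ => QuotientAddGroup.isOpenQuotientMap_mk

lemma torusMk_eq_iff {d : ℕ} {x y : Fin d → ℝ} :
    torusMk x = torusMk y ↔ ∃ k : Fin d → ℤ, y = x + intVec k := by
  constructor
  · intro h
    have : ∀ i, ∃ k : ℤ, y i = x i + k := fun i => by
      have hi : ((x i : ℝ) : UnitAddCircle) = (y i : ℝ) := congrFun h i
      rw [eq_comm, ← sub_eq_zero, ← AddCircle.coe_sub, AddCircle.coe_eq_zero_iff] at hi
      obtain ⟨k, hk⟩ := hi
      exact ⟨k, by simp at hk; linarith⟩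
    choose k hk using this
    exact ⟨k, funext hk⟩
  · rintro ⟨k, rfl⟩
    funext i
    simp [torusMk, intVec]

attribute [local instance] instMeasureSpaceUnitAddCircle

/-- Compact support makes lattice sums finite, with one index set for a whole ball of base points.
Continuity, interchange with integrals and convergence of such sums all rest on this. -/
lemma exists_finset_forall_notMem_eq_zero {d : ℕ} {E : Type*} [Zero E] [TopologicalSpace E]
    {h : (Fin d → ℝ) → E} (hc : HasCompactSupport h) (ρ : ℝ) :
    ∃ T : Finset (Fin d → ℤ), ∀ y : Fin d → ℝ, ‖y‖ ≤ ρ → ∀ m ∉ T, h (y + intVec m) = 0 := by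
  obtain ⟨R, hR⟩ := hc.isCompact.isBounded.subset_closedBall 0
  set N : ℤ := ⌈R + ρ⌉
  refine ⟨(Set.finite_Icc (fun _ : Fin d => -N) (fun _ => N)).toFinset, fun y hy m hm => ?_⟩
  by_contra hne
  refine hm ?_
  have h1 : ‖y + intVec m‖ ≤ R := by
    simpa using hR (subset_tsupport _ hne)
  have h2 : ‖intVec m‖ ≤ R + ρ := by
    have : intVec m = (y + intVec m) - y := by abel
    rw [this]
    exact (norm_sub_le _ _).trans (add_le_add h1 hy)
  have h3 : ∀ i, |m i| ≤ N := fun i => by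
    have := (norm_le_pi_norm (intVec m) i).trans (h2.trans (Int.le_ceil _))
    simp only [intVec, Real.norm_eq_abs] at this
    exact_mod_cast this
  rw [Set.Finite.mem_toFinset]
  exact ⟨fun i => (abs_le.1 (h3 i)).1, fun i => (abs_le.1 (h3 i)).2⟩

lemma continuous_tsum_intVec {d : ℕ} {h : (Fin d → ℝ) → ℂ} (hh : Continuous h)
    (hc : HasCompactSupport h) : Continuous fun y => ∑' m : Fin d → ℤ, h (y + intVec m) := by
  refine continuous_iff_continuousAt.2 fun y₀ => ?_
  obtain ⟨T, hT⟩ := exists_finset_forall_notMem_eq_zero hc (‖y₀‖ + 1)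
  have hev : (fun y => ∑' m : Fin d → ℤ, h (y + intVec m)) =ᶠ[nhds y₀]
      fun y => ∑ m ∈ T, h (y + intVec m) := by
    filter_upwards [Metric.ball_mem_nhds y₀ one_pos] with y hy
    refine tsum_eq_sum fun m hm => hT y ?_ m hm
    have : ‖y - y₀‖ < 1 := by simpa [dist_eq_norm] using hy
    have := norm_le_norm_add_norm_sub' y y₀
    linarith
  refine ContinuousAt.congr ?_ hev.symm
  exact (by fun_prop : Continuous fun y => ∑ m ∈ T, h (y + intVec m)).continuousAt

lemma intVec_add {d : ℕ} (k l : Fin d → ℤ) : intVec (k + l) = intVec k + intVec l := by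
  funext i; simp [intVec]

lemma phase_intVec_dotProduct {d : ℕ} (k l : Fin d → ℤ) :
    phase (-(intVec k ⬝ᵥ intVec l)) = 1 := by
  have : -(intVec k ⬝ᵥ intVec l) = ((-∑ i, k i * l i : ℤ) : ℝ) := by
    simp [dotProduct, intVec]
  rw [this, phase_intCast]

/-- The Fourier coefficients of the periodization of `h` are values of its Fourier transform. -/
lemma mFourierCoeff_periodization {d : ℕ} {h : (Fin d → ℝ) → ℂ} (hh : Continuous h)
    (hc : HasCompactSupport h) {G : UnitAddTorus (Fin d) → ℂ}
    (hG : ∀ y, G (torusMk y) = ∑' m : Fin d → ℤ, h (y + intVec m)) (k : Fin d → ℤ) :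
    UnitAddTorus.mFourierCoeff G k = piFourier h (intVec k) := by
  rw [mFourierCoeff_eq_iocCube, piFourier]
  have hint : Integrable fun x => phase (-(x ⬝ᵥ intVec k)) * h x := by
    refine Continuous.integrable_of_hasCompactSupport ?_ hc.mul_left
    exact (continuous_phase_dotProduct.comp (by fun_prop :
      Continuous fun x : Fin d → ℝ => (x, intVec k))).mul hh
  rw [← (hasSum_integral_iocCube hint).tsum_eq]
  obtain ⟨T, hT⟩ := exists_finset_forall_notMem_eq_zero hc 1
  have hnorm : ∀ x ∈ iocCube d, ‖x‖ ≤ 1 := fun x hx =>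
    (pi_norm_le_iff_of_nonneg zero_le_one).2 fun i => by
      rw [Real.norm_eq_abs, abs_le]
      exact ⟨by linarith [(hx i).1], (hx i).2⟩
  -- Integer frequencies do not see integer translations, so the pieces of the integral over ℝ^d
  -- fold into one integral over the cube.
  have hperiod : ∀ (m : Fin d → ℤ) x, phase (-((x + intVec m) ⬝ᵥ intVec k)) =
      phase (-(x ⬝ᵥ intVec k)) := fun m x => by
    rw [add_dotProduct, neg_add, phase_add, phase_intVec_dotProduct, mul_one]
  rw [tsum_eq_sum (s := T)]
  · rw [← integral_finsetSum]
    · refine setIntegral_congr_fun (measurableSet_iocCube d) fun x hx => ?_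
      have : G (fun i => (x i : UnitAddCircle)) = _ := hG x
      rw [this, tsum_eq_sum (s := T) (fun m hm => hT x (hnorm x hx) m hm), Finset.mul_sum]
      exact Finset.sum_congr rfl fun m _ => by rw [hperiod]
    · intro m _
      exact (hint.comp_add_right (intVec m)).integrableOn
  · intro m hm
    refine setIntegral_eq_zero_of_forall_eq_zero fun x hx => ?_
    rw [hT x (hnorm x hx) m hm, mul_zero]

/-- Poisson summation on `ℝ^d`. -/
theorem hasSum_poisson_summation {d : ℕ} {h : (Fin d → ℝ) → ℂ} (hh : Continuous h)
    (hc : HasCompactSupport h) (hs : Summable fun k : Fin d → ℤ => piFourier h (intVec k))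
    (v : Fin d → ℝ) :
    HasSum (fun k : Fin d → ℤ => piFourier h (intVec k) * phase (v ⬝ᵥ intVec k))
      (∑' m : Fin d → ℤ, h (v + intVec m)) := by
  set g : (Fin d → ℝ) → ℂ := fun y => ∑' m : Fin d → ℤ, h (y + intVec m) with hg
  have hinv : ∀ x y : Fin d → ℝ, torusMk x = torusMk y → g x = g y := by
    intro x y hxy
    obtain ⟨k, rfl⟩ := torusMk_eq_iff.1 hxy
    simp only [hg]
    rw [← (Equiv.addLeft k).tsum_eq]
    simp [intVec_add, add_assoc]
  -- The periodization descends to the torus; the chosen preimage is harmless by `hinv`.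
  set G : UnitAddTorus (Fin d) → ℂ := fun t => g (isOpenQuotientMap_torusMk.surjective t).choose
  have hG : ∀ y, G (torusMk y) = g y := fun y =>
    hinv _ _ (isOpenQuotientMap_torusMk.surjective (torusMk y)).choose_spec
  have hGc : Continuous G := by
    refine isOpenQuotientMap_torusMk.isQuotientMap.continuous_iff.2 ?_
    have : G ∘ torusMk = g := funext hG
    rw [this]
    exact continuous_tsum_intVec hh hc
  have hcoef := mFourierCoeff_periodization hh hc hG
  have := UnitAddTorus.hasSum_mFourier_series_apply_of_summable (f := ⟨G, hGc⟩)
    (by simpa only [ContinuousMap.coe_mk, funext hcoef] using hs) (torusMk v)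
  simp only [ContinuousMap.coe_mk, hcoef, smul_eq_mul, hG] at this
  convert! this using 2 with k
  congr 1
  exact (mFourier_apply_coe k v).symm

/-! ### Parseval and Plancherel for functions supported in the cube. -/

/-- Parseval's identity for a square-integrable function supported in the unit cube. -/
lemma tsum_sq_norm_piFourier {d : ℕ} {g : (Fin d → ℝ) → ℂ} (hg : MemLp g 2)
    (hsupp : ∀ᵐ x, x ∉ iocCube d → g x = 0) (t : Fin d → ℝ) :
    ∑' k : Fin d → ℤ, ‖piFourier g (t + intVec k)‖ₑ ^ 2 = ∫⁻ x, ‖g x‖ₑ ^ 2 := by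
  set e := UnitAddTorus.measurableEquivPiIoc (0 : Fin d → ℝ)
  -- Modulation shifts the Fourier transform by t and keeps the modulus, so Parseval for `g'` gives
  -- the sum over the shifted lattice.
  set g' : (Fin d → ℝ) → ℂ := fun x => phase (-(x ⬝ᵥ t)) * g x with hg'
  have hc : Continuous fun x : Fin d → ℝ => phase (-(x ⬝ᵥ t)) :=
    continuous_phase_dotProduct.comp (by fun_prop : Continuous fun x : Fin d → ℝ => (x, t))
  have hnorm : ∀ x, ‖g' x‖ₑ = ‖g x‖ₑ := fun x => by
    simp only [hg', enorm_mul]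
    rw [← ofReal_norm (phase _), norm_phase, ENNReal.ofReal_one, one_mul]
  have hgL : MemLp g' 2 := by
    refine hg.congr_norm (hc.aestronglyMeasurable.mul hg.1) (Filter.Eventually.of_forall fun x => ?_)
    simp [hg', norm_phase]
  set s : Set (Fin d → ℝ) := {x | ∀ i, x i ∈ Set.Ioc ((0 : Fin d → ℝ) i) ((0 : Fin d → ℝ) i + 1)}
    with hs
  have hsQ : s = iocCube d := by simp [hs, iocCube]
  have hsm : MeasurableSet s := hsQ ▸ measurableSet_iocCube d
  set G : UnitAddTorus (Fin d) → ℂ := fun τ => g' (e τ).1 with hG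
  have hGmk : ∀ x ∈ iocCube d, G (torusMk x) = g' x := by
    intro x hx
    have hxs : x ∈ s := hsQ ▸ hx
    have : e (torusMk x) = ⟨x, hxs⟩ := by
      exact ((Equiv.eq_symm_apply e.toEquiv).1 rfl)
    simp only [hG, this]
  have hGL : MemLp G 2 := by
    have h1 : MemLp (fun y : s => g' y.1) 2 (Measure.comap Subtype.val volume) := by
      have := (MeasurableEmbedding.subtype_coe hsm).memLp_map_measure_iff
        (μ := Measure.comap Subtype.val (volume : Measure (Fin d → ℝ))) (g := g') (p := 2)
      rw [map_comap_subtype_coe hsm] at this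
      exact this.1 (hgL.restrict s)
    exact h1.comp_measurePreserving (UnitAddTorus.measurePreserving_equivPiIoc 0)
  have hcoef : ∀ k, UnitAddTorus.mFourierCoeff (hGL.toLp G) k = piFourier g (t + intVec k) := by
    intro k
    have h1 : UnitAddTorus.mFourierCoeff (hGL.toLp G) k = UnitAddTorus.mFourierCoeff G k := by
      refine integral_congr_ae ?_
      filter_upwards [hGL.coeFn_toLp] with x hx
      rw [hx]
    rw [h1, mFourierCoeff_eq_iocCube, piFourier,
      ← setIntegral_eq_integral_of_ae_compl_eq_zero (s := iocCube d) (μ := volume)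
        (f := fun x => phase (-(x ⬝ᵥ (t + intVec k))) * g x)]
    · refine setIntegral_congr_fun (measurableSet_iocCube d) fun x hx => ?_
      have : G (fun i => (x i : UnitAddCircle)) = _ := hGmk x hx
      rw [this, hg', dotProduct_add, neg_add, phase_add]
      ring
    · filter_upwards [hsupp] with x hx hx'
      rw [hx hx', mul_zero]
  have hpars := UnitAddTorus.hasSum_sq_mFourierCoeff (hGL.toLp G)
  simp only [hcoef] at hpars
  have hint : ∫ τ, ‖hGL.toLp G τ‖ ^ 2 = ∫ τ, ‖G τ‖ ^ 2 := by
    refine integral_congr_ae ?_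
    filter_upwards [hGL.coeFn_toLp] with x hx
    rw [hx]
  rw [hint] at hpars
  have hsq : ∀ z : ℂ, ENNReal.ofReal (‖z‖ ^ 2) = ‖z‖ₑ ^ 2 := fun z => by
    rw [ENNReal.ofReal_pow (norm_nonneg _), ofReal_norm]
  have h2 := congrArg ENNReal.ofReal hpars.tsum_eq
  rw [ENNReal.ofReal_tsum_of_nonneg (fun _ => by positivity) hpars.summable,
    ofReal_integral_eq_lintegral_ofReal (MemLp.integrable_norm_pow (p := 2) (by exact_mod_cast hGL) two_ne_zero)
      (Filter.Eventually.of_forall fun _ => by positivity)] at h2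
  simp only [hsq] at h2
  rw [h2, UnitAddTorus.lintegral_preimage _ 0, ← hs, hsQ,
    ← lintegral_indicator (measurableSet_iocCube d)]
  refine lintegral_congr_ae ?_
  filter_upwards [hsupp] with x hx
  by_cases hxQ : x ∈ iocCube d
  · have : G (fun i => (x i : UnitAddCircle)) = _ := hGmk x hxQ
    rw [Set.indicator_of_mem hxQ, this, hnorm]
  · rw [Set.indicator_of_notMem hxQ, hx hxQ]
    simp

/-- Parseval gives the same value on every shifted lattice t + ℤ^d. Integrating t over the cube, of
volume one, assembles all frequencies. -/
theorem lintegral_sq_norm_piFourier {d : ℕ} {g : (Fin d → ℝ) → ℂ} (hg : MemLp g 2)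
    (hg1 : Integrable g) (hsupp : ∀ᵐ x, x ∉ iocCube d → g x = 0) :
    ∫⁻ ξ, ‖piFourier g ξ‖ₑ ^ 2 = ∫⁻ x, ‖g x‖ₑ ^ 2 := by
  have hm : Measurable fun ξ => ‖piFourier g ξ‖ₑ ^ 2 :=
    (continuous_piFourier hg1).measurable.enorm.pow_const 2
  have hm' : ∀ k : Fin d → ℤ, AEMeasurable (fun x => ‖piFourier g (x + intVec k)‖ₑ ^ 2)
      (volume.restrict (iocCube d)) := fun k =>
    (hm.comp (measurable_add_const (intVec k))).aemeasurable
  rw [lintegral_eq_tsum_iocCube hm, ← lintegral_tsum hm']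
  simp_rw [tsum_sq_norm_piFourier hg hsupp]
  rw [setLIntegral_const, volume_iocCube, mul_one]

/-! ### Tail integrals off a hyperbolic cross. -/

lemma lintegral_comp_abs (g : ℝ → ENNReal) :
    ∫⁻ x : ℝ, g |x| = 2 * ∫⁻ x in Set.Ioi (0 : ℝ), g x := by
  have h1 : ∫⁻ x in Set.Ioi (0 : ℝ), g |x| = ∫⁻ x in Set.Ioi (0 : ℝ), g x :=
    setLIntegral_congr_fun measurableSet_Ioi fun x hx => by rw [abs_of_pos hx]
  have h2 : ∫⁻ x in Set.Iio (0 : ℝ), g |x| = ∫⁻ x in Set.Ioi (0 : ℝ), g x := by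
    rw [← h1, ← (Measure.measurePreserving_neg (volume : Measure ℝ)).setLIntegral_comp_preimage_emb
      (MeasurableEquiv.neg ℝ).measurableEmbedding]
    simp
  rw [← lintegral_add_compl (fun x => g |x|) (measurableSet_Ioi (a := (0 : ℝ))), Set.compl_Ioi,
    setLIntegral_congr Iio_ae_eq_Iic.symm, h1, h2, two_mul]

lemma lintegral_Ici_rpow_tail {r : ℕ} (hr : 1 ≤ r) {t : ℝ} (ht : 1 ≤ t) :
    ∫⁻ y in Set.Ici t, ENNReal.ofReal ((y ^ (2 * r))⁻¹) ≤ ENNReal.ofReal ((t ^ (2 * r - 1))⁻¹) := by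
  have ht0 : 0 < t := by linarith
  have hr' : (1 : ℝ) ≤ r := by exact_mod_cast hr
  have ha : -(2 * r : ℝ) < -1 := by linarith
  rw [setLIntegral_congr Ioi_ae_eq_Ici.symm]
  have hpow : ∀ y ∈ Set.Ioi t, (y ^ (2 * r))⁻¹ = y ^ (-(2 * r : ℝ)) := fun y hy => by
    rw [Real.rpow_neg (ht0.trans hy).le]
    congr 1
    exact_mod_cast (Real.rpow_natCast y (2 * r)).symm
  rw [setLIntegral_congr_fun measurableSet_Ioi (fun y hy => by rw [hpow y hy]),
    ← ofReal_integral_eq_lintegral_ofReal (integrableOn_Ioi_rpow_of_lt ha ht0)]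
  · refine ENNReal.ofReal_le_ofReal ?_
    rw [integral_Ioi_rpow_of_lt ha ht0]
    have : (t ^ (2 * r - 1))⁻¹ = t ^ (-(2 * r : ℝ) + 1) := by
      rw [← Real.rpow_natCast, ← Real.rpow_neg ht0.le, Nat.cast_sub (by omega)]
      congr 1
      push_cast
      ring
    rw [this, show -t ^ (-(2 * r : ℝ) + 1) / (-(2 * r : ℝ) + 1) =
      t ^ (-(2 * r : ℝ) + 1) / (2 * r - 1) by rw [← neg_div_neg_eq]; ring_nf]
    exact div_le_self (Real.rpow_nonneg ht0.le _) (by linarith)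
  · filter_upwards [ae_restrict_mem measurableSet_Ioi] with y hy
    exact Real.rpow_nonneg (ht0.trans hy).le _

lemma lintegral_abs_tail {r : ℕ} (hr : 1 ≤ r) {t : ℝ} (ht : 1 ≤ t) :
    ∫⁻ y : ℝ, (if t ≤ |y| then ENNReal.ofReal ((max 1 |y| ^ (2 * r))⁻¹) else 0) ≤
      2 * ENNReal.ofReal ((t ^ (2 * r - 1))⁻¹) := by
  rw [lintegral_comp_abs fun y => if t ≤ y then ENNReal.ofReal ((max 1 y ^ (2 * r))⁻¹) else 0]
  gcongr
  refine le_trans ?_ (lintegral_Ici_rpow_tail hr ht)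
  rw [← lintegral_indicator measurableSet_Ici, ← lintegral_indicator measurableSet_Ioi]
  refine lintegral_mono fun y => ?_
  by_cases h0 : y ∈ Set.Ioi (0 : ℝ)
  · rw [Set.indicator_of_mem h0]
    by_cases h : t ≤ y
    · rw [Set.indicator_of_mem (by exact h), if_pos h, max_eq_right (ht.trans h)]
    · rw [if_neg h]
      exact zero_le
  · rw [Set.indicator_of_notMem h0]
    exact zero_le

/-- This integral is the source of the logarithms in `exists_crossTail_le`, one for each dimension
beyond the first. -/
lemma lintegral_max_inv_le {t : ℝ} (ht : 1 ≤ t) :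
    ∫⁻ y : ℝ, (if max 1 |y| ≤ t then ENNReal.ofReal ((max 1 |y|)⁻¹) else 0) ≤
      2 * ENNReal.ofReal (1 + Real.log t) := by
  have ht0 : 0 < t := by linarith
  rw [lintegral_comp_abs fun y => if max 1 y ≤ t then ENNReal.ofReal ((max 1 y)⁻¹) else 0]
  gcongr
  rw [ENNReal.ofReal_add zero_le_one (Real.log_nonneg ht)]
  have h1 : ∫⁻ y in Set.Ioc (1 : ℝ) t, ENNReal.ofReal y⁻¹ = ENNReal.ofReal (Real.log t) := by
    have hi : IntervalIntegrable (fun y : ℝ => y⁻¹) volume 1 t := by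
      refine ContinuousOn.intervalIntegrable_of_Icc ht ?_
      exact continuousOn_inv₀.mono fun y hy => (zero_lt_one.trans_le hy.1).ne'
    rw [← ofReal_integral_eq_lintegral_ofReal hi.1, ← intervalIntegral.integral_of_le ht,
      integral_inv_of_pos zero_lt_one ht0, div_one]
    filter_upwards [ae_restrict_mem measurableSet_Ioc] with y hy
    exact inv_nonneg.2 (zero_lt_one.trans hy.1).le
  have h0 : ∫⁻ _ in Set.Ioc (0 : ℝ) 1, (1 : ENNReal) = ENNReal.ofReal 1 := by simp
  rw [← h1, ← h0, ← lintegral_indicator measurableSet_Ioi, ← lintegral_indicator measurableSet_Ioc,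
    ← lintegral_indicator measurableSet_Ioc, ← lintegral_add_left
      (measurable_const.indicator measurableSet_Ioc)]
  refine lintegral_mono fun y => ?_
  by_cases hy0 : y ∈ Set.Ioi (0 : ℝ)
  · rw [Set.indicator_of_mem hy0]
    by_cases hy1 : y ≤ 1
    · rw [Set.indicator_of_mem (show y ∈ Set.Ioc (0 : ℝ) 1 from ⟨hy0, hy1⟩), max_eq_left hy1]
      refine le_add_right ?_
      rw [if_pos ht]
      simp
    · push Not at hy1
      rw [max_eq_right hy1.le]
      by_cases hyt : y ≤ t
      · rw [if_pos hyt, Set.indicator_of_mem (show y ∈ Set.Ioc (1 : ℝ) t from ⟨hy1, hyt⟩)]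
        exact le_add_self
      · rw [if_neg hyt]
        exact zero_le
  · rw [Set.indicator_of_notMem hy0]
    exact zero_le

/-- The product `∏ max(1, |x_i|)`. -/
noncomputable def maxProd {d : ℕ} (x : Fin d → ℝ) : ℝ := ∏ i, max 1 |x i|

lemma one_le_maxProd {d : ℕ} (x : Fin d → ℝ) : 1 ≤ maxProd x := by
  have := Finset.prod_le_prod (s := Finset.univ) (f := fun _ => (1 : ℝ))
    (g := fun i => max 1 |x i|) (fun _ _ => zero_le_one) fun _ _ => le_max_left _ _
  simpa [maxProd] using this

lemma measurable_maxProd {d : ℕ} : Measurable (maxProd (d := d)) := by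
  unfold maxProd
  fun_prop

/-- The integral of `∏ max(1, |x_i|)^{-2r}` over the complement of a hyperbolic cross. -/
noncomputable def crossTail (r d : ℕ) (t : ℝ) : ENNReal :=
  ∫⁻ x : Fin d → ℝ, if t ≤ maxProd x then ENNReal.ofReal ((maxProd x ^ (2 * r))⁻¹) else 0

/-- Tonelli in one coordinate y: `maxProd` is multiplicative, so fixing y only divides the threshold
by max(1,|y|). -/
lemma crossTail_succ (r d : ℕ) (t : ℝ) :
    crossTail r (d + 1) t = ∫⁻ y : ℝ, ENNReal.ofReal ((max 1 |y| ^ (2 * r))⁻¹) *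
      crossTail r d (t / max 1 |y|) := by
  have hmeas : ∀ (d : ℕ) (t : ℝ), Measurable fun x : Fin d → ℝ =>
      if t ≤ maxProd x then ENNReal.ofReal ((maxProd x ^ (2 * r))⁻¹) else 0 := fun d t =>
    Measurable.ite (measurableSet_le measurable_const measurable_maxProd)
      ((measurable_maxProd.pow_const _).inv.ennreal_ofReal) measurable_const
  have hmp := (volume_preserving_piFinSuccAbove (fun _ : Fin (d + 1) => ℝ) 0).symm
  rw [crossTail, ← hmp.lintegral_comp (hmeas _ _), Measure.volume_eq_prod, lintegral_prod]
  · refine lintegral_congr fun y => ?_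
    rw [crossTail, ← lintegral_const_mul _ (hmeas _ _)]
    refine lintegral_congr fun z => ?_
    have hM : (0 : ℝ) < max 1 |y| := lt_max_of_lt_left one_pos
    have hmax : maxProd ((MeasurableEquiv.piFinSuccAbove (fun _ : Fin (d + 1) => ℝ) 0).symm (y, z)) =
        max 1 |y| * maxProd z := by
      simp [maxProd, Fin.prod_univ_succ, MeasurableEquiv.piFinSuccAbove_symm_apply]
    rw [hmax]
    by_cases h : t ≤ max 1 |y| * maxProd z
    · rw [if_pos h, if_pos ((div_le_iff₀' hM).2 h), ← ENNReal.ofReal_mul (by positivity), mul_pow,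
        mul_inv]
    · rw [if_neg h, if_neg (fun h' => h ((div_le_iff₀' hM).1 h')), mul_zero]
  · exact ((hmeas _ _).comp hmp.measurable).aemeasurable

/-- The region |y| ≤ 1 matters only for t = 1, and the indicator of [-1,1] pays for it. Together
with the genuine tail this gives 2 + 2 = 4. -/
lemma crossTail_one_le {r : ℕ} (hr : 1 ≤ r) {t : ℝ} (ht : 1 ≤ t) :
    crossTail r 1 t ≤ ENNReal.ofReal (4 * (t ^ (2 * r - 1))⁻¹) := by
  have h0 : ∀ s, crossTail r 0 s = if s ≤ 1 then 1 else 0 := fun s => by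
    simp [crossTail, maxProd, volume_pi]
  have ht0 : 0 < t := by linarith
  rw [crossTail_succ]
  have hle : ∀ y : ℝ, ENNReal.ofReal ((max 1 |y| ^ (2 * r))⁻¹) * crossTail r 0 (t / max 1 |y|) ≤
      (if t ≤ |y| then ENNReal.ofReal ((max 1 |y| ^ (2 * r))⁻¹) else 0) +
        (Set.Icc (-1 : ℝ) 1).indicator (fun _ => ENNReal.ofReal ((t ^ (2 * r - 1))⁻¹)) y := by
    intro y
    rw [h0]
    by_cases h : t / max 1 |y| ≤ 1
    · rw [if_pos h, mul_one]
      rw [div_le_one (lt_max_of_lt_left one_pos)] at h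
      by_cases hy : |y| ≤ 1
      · rw [Set.indicator_of_mem (show y ∈ Set.Icc (-1 : ℝ) 1 from abs_le.1 hy)]
        rw [max_eq_left hy] at h ⊢
        have : t = 1 := le_antisymm h ht
        simp [this]
      · push Not at hy
        rw [max_eq_right hy.le] at h
        rw [if_pos h]
        exact le_self_add
    · rw [if_neg h, mul_zero]
      exact zero_le
  refine (lintegral_mono hle).trans ?_
  rw [lintegral_add_right _ (measurable_const.indicator measurableSet_Icc),
    lintegral_indicator measurableSet_Icc, setLIntegral_const, Real.volume_Icc]
  refine (add_le_add_left (lintegral_abs_tail hr ht) _).trans (le_of_eq ?_)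
  rw [ENNReal.ofReal_mul (by norm_num), mul_comm (ENNReal.ofReal _) (ENNReal.ofReal (1 - -1)),
    show (1 : ℝ) - -1 = 2 by norm_num, show (4 : ℝ) = 2 + 2 by norm_num,
    ENNReal.ofReal_add (by norm_num) (by norm_num), ENNReal.ofReal_ofNat, add_mul]

lemma crossTail_eq_one {r d : ℕ} {t : ℝ} (ht : t ≤ 1) : crossTail r d t = crossTail r d 1 := by
  unfold crossTail
  refine lintegral_congr fun x => ?_
  rw [if_pos (ht.trans (one_le_maxProd x)), if_pos (one_le_maxProd x)]

/-- The tail integral over the complement of a hyperbolic cross decays like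
`t^{1-2r} (log t)^{d-1}`. -/
theorem exists_crossTail_le {r : ℕ} (hr : 1 ≤ r) (d : ℕ) :
    ∃ C : ℝ, 0 < C ∧ ∀ t : ℝ, 1 ≤ t →
      crossTail r (d + 1) t ≤ ENNReal.ofReal (C * (t ^ (2 * r - 1))⁻¹ * (1 + Real.log t) ^ d) := by
  induction d with
  | zero => exact ⟨4, by norm_num, fun t ht => by simpa using crossTail_one_le hr ht⟩
  | succ d ih =>
    obtain ⟨C, hC, ih⟩ := ih
    -- Each of the two ranges max(1,|y|) ≤ t and max(1,|y|) > t contributes 2 C.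
    refine ⟨4 * C, by positivity, fun t ht => ?_⟩
    have ht0 : 0 < t := by linarith
    have hlog := Real.log_nonneg ht
    set A : ℝ := C * (t ^ (2 * r - 1))⁻¹ * (1 + Real.log t) ^ d with hA
    have hA0 : 0 ≤ A := by positivity
    -- With M = max(1,|y|), for M ≤ t the powers combine as M^{-2r} (t/M)^{1-2r} = t^{1-2r} M^{-1},
    -- and integrating M^{-1} costs one logarithm. For M > t the threshold is below 1, the inner
    -- integral is at most C, and the tail in y supplies the decay.
    have hle : ∀ y : ℝ, ENNReal.ofReal ((max 1 |y| ^ (2 * r))⁻¹) *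
        crossTail r (d + 1) (t / max 1 |y|) ≤
        ENNReal.ofReal A * (if max 1 |y| ≤ t then ENNReal.ofReal ((max 1 |y|)⁻¹) else 0) +
        ENNReal.ofReal C * (if t ≤ |y| then ENNReal.ofReal ((max 1 |y| ^ (2 * r))⁻¹) else 0) := by
      intro y
      set M : ℝ := max 1 |y| with hM
      have hM1 : 1 ≤ M := le_max_left _ _
      have hM0 : 0 < M := by linarith
      by_cases h : M ≤ t
      · refine le_add_right ?_
        rw [if_pos h]
        refine (mul_le_mul_right (ih _ ((one_le_div hM0).2 h)) _).trans ?_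
        rw [← ENNReal.ofReal_mul (by positivity), ← ENNReal.ofReal_mul hA0]
        refine ENNReal.ofReal_le_ofReal ?_
        have hl : Real.log (t / M) ≤ Real.log t :=
          Real.log_le_log (by positivity) (div_le_self ht0.le hM1)
        have hl0 : 0 ≤ Real.log (t / M) := Real.log_nonneg ((one_le_div hM0).2 h)
        have hpow : (M ^ (2 * r))⁻¹ * ((t / M) ^ (2 * r - 1))⁻¹ = (t ^ (2 * r - 1))⁻¹ * M⁻¹ := by
          obtain ⟨k, hk⟩ : ∃ k, 2 * r = k + 1 := ⟨2 * r - 1, by omega⟩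
          rw [hk, Nat.add_sub_cancel, div_pow, pow_succ]
          field_simp
        calc (M ^ (2 * r))⁻¹ * (C * ((t / M) ^ (2 * r - 1))⁻¹ * (1 + Real.log (t / M)) ^ d)
            = C * ((M ^ (2 * r))⁻¹ * ((t / M) ^ (2 * r - 1))⁻¹) * (1 + Real.log (t / M)) ^ d := by
              ring
          _ = C * ((t ^ (2 * r - 1))⁻¹ * M⁻¹) * (1 + Real.log (t / M)) ^ d := by rw [hpow]
          _ ≤ C * ((t ^ (2 * r - 1))⁻¹ * M⁻¹) * (1 + Real.log t) ^ d := by gcongr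
          _ = A * M⁻¹ := by rw [hA]; ring
      · push Not at h
        refine le_add_left ?_
        have hyt : t ≤ |y| := by
          rcases le_max_iff.1 (hM ▸ h.le : t ≤ max 1 |y|) with h' | h'
          · rcases max_choice 1 |y| with h'' | h''
            · rw [hM, h''] at h
              linarith
            · rw [hM, h''] at h
              exact h.le
          · exact h'
        rw [if_pos hyt, mul_comm]
        refine mul_le_mul_left ?_ _
        rw [crossTail_eq_one ((div_le_one hM0).2 h.le)]
        simpa using ih 1 le_rfl
    rw [crossTail_succ]
    refine (lintegral_mono hle).trans ?_
    have hm : Measurable fun y : ℝ => if max 1 |y| ≤ t then ENNReal.ofReal ((max 1 |y|)⁻¹) else 0 :=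
      Measurable.ite (measurableSet_le (by fun_prop) measurable_const) (by fun_prop)
        measurable_const
    rw [lintegral_add_left (hm.const_mul _), lintegral_const_mul _ hm, lintegral_const_mul' _ _
      ENNReal.ofReal_ne_top]
    refine (add_le_add (mul_le_mul_right (lintegral_max_inv_le ht) _)
      (mul_le_mul_right (lintegral_abs_tail hr ht) _)).trans ?_
    rw [← ENNReal.ofReal_ofNat, ← ENNReal.ofReal_mul (p := 2) (by norm_num),
      ← ENNReal.ofReal_mul (p := 2) (by norm_num), ← ENNReal.ofReal_mul hA0,
      ← ENNReal.ofReal_mul hC.le,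
      ← ENNReal.ofReal_add (by positivity) (by positivity)]
    refine ENNReal.ofReal_le_ofReal ?_
    have h1 : (1 : ℝ) ≤ (1 + Real.log t) ^ (d + 1) := one_le_pow₀ (by linarith)
    have h2 : C * (2 * (t ^ (2 * r - 1))⁻¹) ≤
        C * (2 * (t ^ (2 * r - 1))⁻¹) * (1 + Real.log t) ^ (d + 1) :=
      le_mul_of_one_le_right (by positivity) h1
    calc A * (2 * (1 + Real.log t)) + C * (2 * (t ^ (2 * r - 1))⁻¹)
        ≤ A * (2 * (1 + Real.log t)) + C * (2 * (t ^ (2 * r - 1))⁻¹) *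
          (1 + Real.log t) ^ (d + 1) := by linarith
      _ = 4 * C * (t ^ (2 * r - 1))⁻¹ * (1 + Real.log t) ^ (d + 1) := by rw [hA]; ring

/-! ### Averaging a dilated Frolov lattice. -/

lemma lintegral_comp_mul_pi {d : ℕ} {a : Fin d → ℝ} (ha : ∀ i, a i ≠ 0) {H : (Fin d → ℝ) → ENNReal}
    (hH : Measurable H) :
    ∫⁻ u, H (a * u) = ENNReal.ofReal |∏ i, a i|⁻¹ * ∫⁻ x, H x := by
  have hp : ∏ i, a i ≠ 0 := Finset.prod_ne_zero_iff.2 fun i _ => ha i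
  have hdet : (Matrix.diagonal a).det ≠ 0 := by rwa [Matrix.det_diagonal]
  have h := Real.smul_map_diagonal_volume_pi hdet
  have hlin : ⇑(Matrix.toLin' (Matrix.diagonal a)) = fun u => a * u := by
    funext u i
    simp [Matrix.toLin'_apply, Matrix.mulVec_diagonal]
  rw [hlin, Matrix.det_diagonal] at h
  have hmeas : Measurable fun u : Fin d → ℝ => a * u := measurable_const_mul a
  conv_rhs => rw [← h, lintegral_smul_measure, lintegral_map hH hmeas]
  rw [smul_eq_mul, ← mul_assoc, ← ENNReal.ofReal_mul (by positivity),
    inv_mul_cancel₀ (abs_ne_zero.2 hp), ENNReal.ofReal_one, one_mul]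

lemma measurableSet_dilationBox (d : ℕ) : MeasurableSet (dilationBox d) :=
  MeasurableSet.univ_pi' fun _ => measurableSet_Icc

/-- This makes coordinatewise multiplication by B m an admissible change of variables. -/
lemma IsFrolovMatrix.mulVec_ne_zero {d : ℕ} {B : Matrix (Fin d) (Fin d) ℝ} (hB : IsFrolovMatrix B)
    {m : Fin d → ℤ} (hm : m ≠ 0) (i : Fin d) : (B *ᵥ intVec m) i ≠ 0 := by
  intro h
  have h1 := hB.one_le_prod m hm
  have h2 : ∏ j, (B *ᵥ fun i => (m i : ℝ)) j = 0 := Finset.prod_eq_zero (Finset.mem_univ i) h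
  rw [h2, abs_zero] at h1
  linarith

/-- For each point, the weighted number of dilated lattice points whose dilation range contains
it is controlled by the reciprocal of the dilation. -/
lemma IsFrolovMatrix.tsum_dilationBox_le {d : ℕ} {B : Matrix (Fin d) (Fin d) ℝ}
    (hB : IsFrolovMatrix B) (hd : 1 ≤ d) {ν : ℝ} (hν : 0 < ν) (x : Fin d → ℝ) :
    ∑' m : Fin d → ℤ, (if m = 0 then 0 else
      ENNReal.ofReal |∏ i, (ν • (B *ᵥ intVec m)) i|⁻¹ *
        (dilationBox d).indicator 1 ((ν • (B *ᵥ intVec m))⁻¹ * x)) ≤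
      if ν ^ d ≤ maxProd x then ENNReal.ofReal (4 / ν ^ d) else 0 := by
  have hd0 : d ≠ 0 := by omega
  set β : ℝ := 2 ^ (1 / (d : ℝ)) with hβ
  have hβ1 : 1 ≤ β := Real.one_le_rpow (by norm_num) (by positivity)
  have hβ0 : 0 < β := by linarith
  have hβd : β ^ d = 2 := by
    rw [hβ, one_div]
    exact Real.rpow_inv_natCast_pow (by norm_num) hd0
  have hνd : 0 < ν ^ d := by positivity
  -- Here x = ν Bm·u with 1 ≤ u_j ≤ β, so 1 ≤ ∏ u_j ≤ β^d = 2. Hence |∏ x_j| lies between |∏ (ν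
  -- Bm)_j| ≥ ν^d and its double, and (Bm)_j = x_j/(ν u_j) lies between x_j/(νβ) and x_j/ν.
  have key : ∀ m : Fin d → ℤ, m ≠ 0 → (ν • (B *ᵥ intVec m))⁻¹ * x ∈ dilationBox d →
      ν ^ d ≤ |∏ i, x i| ∧ |∏ i, (ν • (B *ᵥ intVec m)) i|⁻¹ ≤ 2 / |∏ i, x i| ∧
      ∀ j, (B *ᵥ intVec m) j ∈ Set.uIcc (x j / ν) (x j / (ν * β)) := by
    intro m hm hx
    set b := B *ᵥ intVec m with hb
    set u := (ν • b)⁻¹ * x with hu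
    have hb0 : ∀ i, b i ≠ 0 := hB.mulVec_ne_zero hm
    have hxu : ∀ i, x i = (ν • b) i * u i := fun i => by
      have := hb0 i
      simp only [hu, Pi.mul_apply, Pi.inv_apply, Pi.smul_apply, smul_eq_mul]
      field_simp
    have hu1 : ∀ i, 1 ≤ u i := fun i => (hx i).1
    have huβ : ∀ i, u i ≤ β := fun i => (hx i).2
    have hu0 : ∀ i, 0 < u i := fun i => by linarith [hu1 i]
    have hprod : |∏ i, x i| = |∏ i, (ν • b) i| * ∏ i, u i := by
      rw [Finset.prod_congr rfl fun i _ => hxu i, Finset.prod_mul_distrib, abs_mul,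
        abs_of_nonneg (Finset.prod_nonneg fun i _ => (hu0 i).le)]
    have hprodu1 : 1 ≤ ∏ i, u i := by
      simpa using Finset.prod_le_prod (s := Finset.univ) (f := fun _ => (1 : ℝ))
        (fun _ _ => zero_le_one) fun i _ => hu1 i
    have hprodu2 : ∏ i, u i ≤ 2 := by
      have := Finset.prod_le_prod (s := Finset.univ) (g := fun _ => β)
        (fun i _ => (hu0 i).le) fun i _ => huβ i
      simpa [hβd] using this
    have hprodb : ν ^ d ≤ |∏ i, (ν • b) i| := by
      have : ∏ i, (ν • b) i = ν ^ d * ∏ i, b i := by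
        simp [Finset.prod_mul_distrib]
      rw [this, abs_mul, abs_of_pos hνd]
      exact le_mul_of_one_le_right hνd.le (hB.one_le_prod m hm)
    have hpos : 0 < |∏ i, (ν • b) i| := by linarith
    refine ⟨?_, ?_, fun j => ?_⟩
    · rw [hprod]
      exact hprodb.trans (le_mul_of_one_le_right hpos.le hprodu1)
    · rw [hprod, le_div_iff₀ (by positivity)]
      field_simp
      exact hprodu2
    · have h1 : x j / ν = b j * u j := by
        rw [hxu j]; simp only [Pi.smul_apply, smul_eq_mul]; field_simp
      have h2 : x j / (ν * β) = b j * u j / β := by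
        rw [← div_div, h1]
      rw [h1, h2, Set.mem_uIcc]
      have h3 : u j / β ≤ 1 := (div_le_one hβ0).2 (huβ j)
      rcases le_total 0 (b j) with h | h
      · right
        constructor
        · rw [mul_div_assoc]
          exact mul_le_of_le_one_right h h3
        · exact le_mul_of_one_le_right h (hu1 j)
      · left
        constructor
        · nlinarith [hu1 j]
        · rw [mul_div_assoc]
          nlinarith
  by_cases hex : ∃ m : Fin d → ℤ, m ≠ 0 ∧ (ν • (B *ᵥ intVec m))⁻¹ * x ∈ dilationBox d
  swap
  · push Not at hex
    refine le_of_eq_of_le (ENNReal.tsum_eq_zero.2 fun m => ?_) zero_le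
    by_cases hm : m = 0
    · rw [if_pos hm]
    · rw [if_neg hm, Set.indicator_of_notMem (hex m hm), mul_zero]
  obtain ⟨m₀, hm₀, hx₀⟩ := hex
  have hX := (key m₀ hm₀ hx₀).1
  have hX0 : 0 < |∏ i, x i| := by linarith
  have hmax : |∏ i, x i| ≤ maxProd x := by
    rw [Finset.abs_prod]
    exact Finset.prod_le_prod (fun _ _ => abs_nonneg _) fun _ _ => le_max_right _ _
  rw [if_pos (hX.trans hmax)]
  obtain ⟨hfin, hcard⟩ := hB.box_count (fun j => x j / ν) fun j => x j / (ν * β)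
  rw [Set.ncard_eq_toFinset_card _ hfin] at hcard
  rw [tsum_eq_sum (s := hfin.toFinset)]
  · refine (Finset.sum_le_card_nsmul _ _ (ENNReal.ofReal (2 / |∏ i, x i|)) fun m _ => ?_).trans ?_
    · by_cases hm : m = 0
      · rw [if_pos hm]; exact zero_le
      · rw [if_neg hm]
        by_cases hx : (ν • (B *ᵥ intVec m))⁻¹ * x ∈ dilationBox d
        · rw [Set.indicator_of_mem hx, Pi.one_apply, mul_one]
          exact ENNReal.ofReal_le_ofReal (key m hm hx).2.1
        · rw [Set.indicator_of_notMem hx, mul_zero]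
          exact zero_le
    · rw [nsmul_eq_mul, ← ENNReal.ofReal_natCast, ← ENNReal.ofReal_mul (by positivity)]
      refine ENNReal.ofReal_le_ofReal ?_
      have hbox : ∏ j, |x j / ν - x j / (ν * β)| ≤ |∏ i, x i| / ν ^ d := by
        have : |∏ i, x i| / ν ^ d = ∏ i, |x i| / ν := by
          rw [Finset.prod_div_distrib, Finset.abs_prod]; simp
        rw [this]
        refine Finset.prod_le_prod (fun _ _ => abs_nonneg _) fun i _ => ?_
        have : x i / ν - x i / (ν * β) = x i / ν * (1 - β⁻¹) := by field_simp
        rw [this, abs_mul, abs_div, abs_of_pos hν]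
        refine mul_le_of_le_one_right (by positivity) ?_
        have h1 : β⁻¹ ≤ 1 := inv_le_one_of_one_le₀ hβ1
        have h2 : 0 < β⁻¹ := by positivity
        rw [abs_le]
        constructor <;> linarith
      -- The additive 1 of the box count is absorbed by doubling its main term; with the weight 2/|∏
      -- x_i| this makes the 4.
      have hone : 1 ≤ |∏ i, x i| / ν ^ d := (one_le_div hνd).2 hX
      calc _ ≤ (2 * (|∏ i, x i| / ν ^ d)) * (2 / |∏ i, x i|) := by
            gcongr
            linarith
        _ = 4 / ν ^ d := by field_simp; norm_num
  · intro m hm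
    by_cases hm0 : m = 0
    · rw [if_pos hm0]
    · rw [if_neg hm0, Set.indicator_of_notMem, mul_zero]
      intro hx
      exact hm (hfin.mem_toFinset.2 (key m hm0 hx).2.2)

/-- Averaging over the dilations turns the sum over the dilated lattice into an integral over
the complement of a hyperbolic cross. -/
theorem IsFrolovMatrix.tsum_lintegral_dilationBox_le {d : ℕ} {B : Matrix (Fin d) (Fin d) ℝ}
    (hB : IsFrolovMatrix B) (hd : 1 ≤ d) {ν : ℝ} (hν : 0 < ν) {F : (Fin d → ℝ) → ENNReal}
    (hF : Measurable F) :
    ∑' m : Fin d → ℤ, (if m = 0 then 0 else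
      ∫⁻ u in dilationBox d, F (ν • (B *ᵥ intVec m) * u)) ≤
      ENNReal.ofReal (4 / ν ^ d) * ∫⁻ x, if ν ^ d ≤ maxProd x then F x else 0 := by
  have hind : Measurable ((dilationBox d).indicator (1 : (Fin d → ℝ) → ENNReal)) :=
    measurable_one.indicator (measurableSet_dilationBox d)
  have hmeas : ∀ m : Fin d → ℤ, Measurable fun x : Fin d → ℝ =>
      (dilationBox d).indicator (1 : (Fin d → ℝ) → ENNReal) ((ν • (B *ᵥ intVec m))⁻¹ * x) :=
    fun m => hind.comp (measurable_const_mul _)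
  -- After substituting x = ν Bm·u, m enters only through a weight on F, so the sum can be moved
  -- inside the integral and bounded pointwise.
  have hterm : ∀ m : Fin d → ℤ, (if m = 0 then 0 else
      ∫⁻ u in dilationBox d, F (ν • (B *ᵥ intVec m) * u)) =
      ∫⁻ x, (if m = 0 then 0 else ENNReal.ofReal |∏ i, (ν • (B *ᵥ intVec m)) i|⁻¹ *
        (dilationBox d).indicator 1 ((ν • (B *ᵥ intVec m))⁻¹ * x)) * F x := by
    intro m
    by_cases hm : m = 0
    · simp [hm]
    · simp only [if_neg hm, mul_assoc]
      set a := ν • (B *ᵥ intVec m) with ha_def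
      have ha : ∀ i, a i ≠ 0 := fun i => mul_ne_zero hν.ne' (hB.mulVec_ne_zero hm i)
      have hH : Measurable fun x => (dilationBox d).indicator (1 : (Fin d → ℝ) → ENNReal)
          (a⁻¹ * x) * F x := (hmeas m).mul hF
      rw [lintegral_const_mul _ hH, ← lintegral_comp_mul_pi ha hH,
        ← lintegral_indicator (measurableSet_dilationBox d)]
      refine lintegral_congr fun u => ?_
      have : a⁻¹ * (a * u) = u := by
        funext i
        simp [ha i]
      rw [this]
      by_cases hu : u ∈ dilationBox d <;> simp [hu]
  simp_rw [hterm]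
  rw [← lintegral_tsum]
  · simp_rw [ENNReal.tsum_mul_right]
    rw [← lintegral_const_mul' _ _ ENNReal.ofReal_ne_top]
    refine lintegral_mono fun x => ?_
    refine (mul_le_mul_left (hB.tsum_dilationBox_le hd hν x) _).trans ?_
    split_ifs <;> simp
  · intro m
    by_cases hm : m = 0
    · simp [hm]
    · simp only [if_neg hm]
      exact (((hmeas m).const_mul _).mul hF).aemeasurable

/-! ### Plane waves and weak derivatives. -/

/-- The plane wave `x ↦ cos (θ - 2 π x·ξ)`. -/
noncomputable def cosWave {d : ℕ} (ξ : Fin d → ℝ) (θ : ℝ) (x : EuclideanSpace ℝ (Fin d)) : ℝ :=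
  Real.cos (θ - 2 * Real.pi * (x.ofLp ⬝ᵥ ξ))

lemma contDiff_cosWave {d : ℕ} (ξ : Fin d → ℝ) (θ : ℝ) : ContDiff ℝ ∞ (cosWave ξ θ) := by
  unfold cosWave dotProduct
  fun_prop

/-- Differentiation lowers the phase by π/2, so real multiples of `cosWave` are closed under it.
This keeps the test functions real, as `HasWeakDerivOn` requires. -/
lemma partialDeriv_cosWave {d : ℕ} (ξ : Fin d → ℝ) (θ c : ℝ) (i : Fin d) :
    partialDeriv i (fun x => c * cosWave ξ θ x) =
      fun x => c * (2 * Real.pi * ξ i) * cosWave ξ (θ - Real.pi / 2) x := by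
  funext x
  set ℓ : EuclideanSpace ℝ (Fin d) →L[ℝ] ℝ := ∑ j, ξ j • EuclideanSpace.proj j with hℓ
  have hℓx : ∀ x, x.ofLp ⬝ᵥ ξ = ℓ x := fun x => by
    simp [hℓ, dotProduct, mul_comm]
  have hfun : (fun x => c * cosWave ξ θ x) = fun x => c * Real.cos (θ - 2 * Real.pi * ℓ x) := by
    funext x; rw [cosWave, hℓx]
  have hd := (((ℓ.hasFDerivAt (x := x)).const_mul (2 * Real.pi)).const_sub θ).cos.const_mul c
  rw [partialDeriv, hfun, hd.fderiv, cosWave, hℓx]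
  have hℓi : ℓ (EuclideanSpace.single i 1) = ξ i := by
    rw [← hℓx]
    simp [dotProduct, PiLp.single_apply]
  rw [show θ - Real.pi / 2 - 2 * Real.pi * ℓ x = (θ - 2 * Real.pi * ℓ x) - Real.pi / 2 by ring,
    Real.cos_sub_pi_div_two]
  simp [hℓi]
  ring

lemma iterate_partialDeriv_cosWave {d : ℕ} (ξ : Fin d → ℝ) (θ c : ℝ) (i : Fin d) (k : ℕ) :
    (partialDeriv i)^[k] (fun x => c * cosWave ξ θ x) =
      fun x => c * (2 * Real.pi * ξ i) ^ k * cosWave ξ (θ - k * (Real.pi / 2)) x := by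
  induction k with
  | zero => simp
  | succ k ih =>
    rw [Function.iterate_succ_apply', ih, partialDeriv_cosWave]
    funext x
    push_cast
    rw [pow_succ]
    congr 1
    · ring
    · congr 1
      ring

lemma multiDeriv_cosWave {d : ℕ} (ξ : Fin d → ℝ) (θ : ℝ) (α : Fin d → ℕ) :
    multiDeriv α (cosWave ξ θ) = fun x => (∏ i, (2 * Real.pi * ξ i) ^ α i) *
      cosWave ξ (θ - (∑ i, α i : ℕ) * (Real.pi / 2)) x := by
  have h : ∀ l : List (Fin d),
      l.foldr (fun i ψ => (partialDeriv i)^[α i] ψ) (cosWave ξ θ) =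
      fun x => (l.map fun i => (2 * Real.pi * ξ i) ^ α i).prod *
        cosWave ξ (θ - ((l.map α).sum : ℕ) * (Real.pi / 2)) x := by
    intro l
    induction l with
    | nil => simp
    | cons i l ih =>
      rw [List.foldr_cons, ih, iterate_partialDeriv_cosWave]
      funext x
      rw [List.map_cons, List.prod_cons, List.map_cons, List.sum_cons]
      push_cast
      congr 1
      · ring
      · congr 1
        ring
  rw [multiDeriv, h, Fin.prod_univ_def, Fin.sum_univ_def]

lemma multiDeriv_congr {d : ℕ} (α : Fin d → ℕ) {φ ψ : EuclideanSpace ℝ (Fin d) → ℝ}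
    {x : EuclideanSpace ℝ (Fin d)} (h : φ =ᶠ[nhds x] ψ) :
    multiDeriv α φ =ᶠ[nhds x] multiDeriv α ψ := by
  have h1 : ∀ (i : Fin d) (φ ψ : EuclideanSpace ℝ (Fin d) → ℝ), φ =ᶠ[nhds x] ψ →
      partialDeriv i φ =ᶠ[nhds x] partialDeriv i ψ := fun i φ ψ h => by
    filter_upwards [h.fderiv (𝕜 := ℝ)] with y hy
    rw [partialDeriv, partialDeriv, hy]
  have h2 : ∀ (i : Fin d) (k : ℕ) (φ ψ : EuclideanSpace ℝ (Fin d) → ℝ), φ =ᶠ[nhds x] ψ →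
      (partialDeriv i)^[k] φ =ᶠ[nhds x] (partialDeriv i)^[k] ψ := fun i k => by
    induction k with
    | zero => exact fun φ ψ h => h
    | succ k ih => exact fun φ ψ h => ih _ _ (h1 i φ ψ h)
  unfold multiDeriv
  induction List.finRange d with
  | nil => exact h
  | cons i l ih => exact h2 i _ _ _ ih

lemma multiDeriv_zero {d : ℕ} (α : Fin d → ℕ) :
    multiDeriv α (0 : EuclideanSpace ℝ (Fin d) → ℝ) = 0 := by
  have h1 : ∀ i : Fin d, partialDeriv i (0 : EuclideanSpace ℝ (Fin d) → ℝ) = 0 := fun i => by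
    funext x
    simp [partialDeriv]
  have h2 : ∀ (i : Fin d) (k : ℕ), (partialDeriv i)^[k] (0 : EuclideanSpace ℝ (Fin d) → ℝ) = 0 :=
    fun i k => Function.iterate_fixed (h1 i) k
  unfold multiDeriv
  induction List.finRange d with
  | nil => rfl
  | cons i l ih => rw [List.foldr_cons, ih, h2]

lemma multiDeriv_eq_zero_of_notMem_tsupport {d : ℕ} (α : Fin d → ℕ)
    {φ : EuclideanSpace ℝ (Fin d) → ℝ} {x : EuclideanSpace ℝ (Fin d)} (h : x ∉ tsupport φ) :
    multiDeriv α φ x = 0 := by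
  have := (multiDeriv_congr α (notMem_tsupport_iff_eventuallyEq.1 h)).eq_of_nhds
  rw [this, multiDeriv_zero]
  rfl

lemma isClosed_unitCube (d : ℕ) : IsClosed (unitCube d) := by
  have : unitCube d = ⋂ i, (fun x : EuclideanSpace ℝ (Fin d) => x i) ⁻¹' Set.Icc 0 1 := by
    ext; simp [unitCube]
  rw [this]
  exact isClosed_iInter fun i => isClosed_Icc.preimage (by fun_prop)

lemma isOpen_openUnitCube (d : ℕ) : IsOpen (openUnitCube d) := by
  have : openUnitCube d = ⋂ i, (fun x : EuclideanSpace ℝ (Fin d) => x i) ⁻¹' Set.Ioo 0 1 := by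
    ext; simp [openUnitCube]
  rw [this]
  exact isOpen_iInter_of_finite fun i => isOpen_Ioo.preimage (by fun_prop)

lemma unitCube_subset_ball (d : ℕ) :
    unitCube d ⊆ Metric.ball (0 : EuclideanSpace ℝ (Fin d)) (d + 1) := by
  intro x hx
  rw [mem_ball_zero_iff, EuclideanSpace.norm_eq, Real.sqrt_lt' (by positivity)]
  have h1 : ∑ i, ‖x i‖ ^ 2 ≤ ∑ _i : Fin d, (1 : ℝ) := Finset.sum_le_sum fun i _ => by
    rw [Real.norm_eq_abs, abs_of_nonneg (hx i).1]
    exact pow_le_one₀ (hx i).1 (hx i).2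
  simp only [Finset.sum_const, Finset.card_univ, Fintype.card_fin, nsmul_eq_mul, mul_one] at h1
  have : (0 : ℝ) ≤ d := Nat.cast_nonneg d
  nlinarith

lemma volume_unitCube_lt_top (d : ℕ) : volume (unitCube d) < ⊤ :=
  (measure_mono (unitCube_subset_ball d)).trans_lt measure_ball_lt_top

lemma ae_unitCube_imp_openUnitCube (d : ℕ) :
    ∀ᵐ x : EuclideanSpace ℝ (Fin d), x ∈ unitCube d → x ∈ openUnitCube d := by
  have h1 : ∀ᵐ x : Fin d → ℝ, ∀ i, x i ≠ 0 ∧ x i ≠ 1 := by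
    rw [ae_all_iff]
    intro i
    have h : ∀ c : ℝ, ∀ᵐ x : Fin d → ℝ, x i ≠ c := fun c => by
      rw [ae_iff]
      have : {x : Fin d → ℝ | ¬ x i ≠ c} = {x | x i = c} := by ext; simp
      rw [this]
      exact Measure.pi_hyperplane (α := fun _ : Fin d => ℝ) (fun _ => volume) i c
    filter_upwards [h 0, h 1] with x h0 h1 using ⟨h0, h1⟩
  have h2 := (PiLp.volume_preserving_ofLp (Fin d)).quasiMeasurePreserving.ae h1
  filter_upwards [h2] with x hx hxc i
  exact ⟨lt_of_le_of_ne (hxc i).1 (hx i).1.symm, lt_of_le_of_ne (hxc i).2 (hx i).2⟩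

/-- Test functions supported off the cube meet only zeros of f, so g integrates to zero against all
of them. -/
lemma HasWeakDerivOn.ae_eq_zero_of_notMem {d : ℕ} {α : Fin d → ℕ}
    {f g : EuclideanSpace ℝ (Fin d) → ℝ} (h : HasWeakDerivOn Set.univ α f g)
    (hf : tsupport f ⊆ unitCube d) : ∀ᵐ x, x ∉ unitCube d → g x = 0 := by
  obtain ⟨-, hg, h⟩ := h
  simp only [Measure.restrict_univ] at h
  refine (isClosed_unitCube d).isOpen_compl.ae_eq_zero_of_integral_contDiff_smul_eq_zero
    (hg.mono_set (Set.subset_univ _)) fun φ hφ hφc hφs => ?_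
  have h0 : ∫ x, f x * multiDeriv α φ x = 0 := by
    refine integral_eq_zero_of_ae (Filter.Eventually.of_forall fun x => ?_)
    by_cases hx : x ∈ unitCube d
    · have := multiDeriv_eq_zero_of_notMem_tsupport α fun h' => hφs h' hx
      simp [this]
    · have : f x = 0 := image_eq_zero_of_notMem_tsupport fun h' => hx (hf h')
      simp [this]
  have h1 := h φ hφ hφc (Set.subset_univ _)
  rw [h0] at h1
  have h2 := (mul_eq_zero.1 h1.symm).resolve_left (by simp)
  rw [← h2]
  exact integral_congr_ae (Filter.Eventually.of_forall fun x => by simp [mul_comm])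

/-- Membership is stated on ℝ^d and the norm on the open cube; this lemma and the uniqueness in
`HasWeakDerivOn.ae_eq` identify the two derivatives there. -/
lemma HasWeakDerivOn.mono {d : ℕ} {α : Fin d → ℕ} {Ω : Set (EuclideanSpace ℝ (Fin d))}
    {f g : EuclideanSpace ℝ (Fin d) → ℝ} (h : HasWeakDerivOn Set.univ α f g) :
    HasWeakDerivOn Ω α f g := by
  obtain ⟨hf, hg, h⟩ := h
  refine ⟨hf.mono_set (Set.subset_univ _), hg.mono_set (Set.subset_univ _),
    fun φ hφ hφc hφs => ?_⟩
  have := h φ hφ hφc (Set.subset_univ _)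
  simp only [Measure.restrict_univ] at this
  rw [setIntegral_eq_integral_of_forall_compl_eq_zero,
    setIntegral_eq_integral_of_forall_compl_eq_zero, this]
  · intro x hx
    rw [image_eq_zero_of_notMem_tsupport fun h' => hx (hφs h'), mul_zero]
  · intro x hx
    rw [multiDeriv_eq_zero_of_notMem_tsupport α fun h' => hx (hφs h'), mul_zero]

lemma integrable_mul_of_locallyIntegrableOn {d : ℕ} {Ω : Set (EuclideanSpace ℝ (Fin d))}
    {g φ : EuclideanSpace ℝ (Fin d) → ℝ} (hg : LocallyIntegrableOn g Ω) (hφ : Continuous φ)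
    (hφc : HasCompactSupport φ) (hφs : tsupport φ ⊆ Ω) : Integrable fun x => g x * φ x := by
  have h1 : IntegrableOn g (tsupport φ) :=
    (hg.mono_set hφs).integrableOn_isCompact hφc.isCompact
  have h2 : IntegrableOn (fun x => g x * φ x) (tsupport φ) := by
    exact h1.mul_continuousOn hφ.continuousOn hφc.isCompact
  exact h2.integrable_of_forall_notMem_eq_zero fun x hx => by
    rw [image_eq_zero_of_notMem_tsupport hx, mul_zero]

lemma HasWeakDerivOn.ae_eq {d : ℕ} {α : Fin d → ℕ} {Ω : Set (EuclideanSpace ℝ (Fin d))}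
    (hΩ : IsOpen Ω) {f g₁ g₂ : EuclideanSpace ℝ (Fin d) → ℝ} (h₁ : HasWeakDerivOn Ω α f g₁)
    (h₂ : HasWeakDerivOn Ω α f g₂) : ∀ᵐ x, x ∈ Ω → g₁ x = g₂ x := by
  obtain ⟨-, hg₁, h₁⟩ := h₁
  obtain ⟨-, hg₂, h₂⟩ := h₂
  have := hΩ.ae_eq_zero_of_integral_contDiff_smul_eq_zero (hg₁.sub hg₂) fun φ hφ hφc hφs => by
    have h := (h₁ φ hφ hφc hφs).symm.trans (h₂ φ hφ hφc hφs)
    have h' := mul_left_cancel₀ (by simp) h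
    have hz : ∀ g : EuclideanSpace ℝ (Fin d) → ℝ, ∫ x in Ω, g x * φ x = ∫ x, g x * φ x := fun g =>
      setIntegral_eq_integral_of_forall_compl_eq_zero fun x hx => by
        rw [image_eq_zero_of_notMem_tsupport fun h' => hx (hφs h'), mul_zero]
    rw [hz, hz] at h'
    have hi₁ := integrable_mul_of_locallyIntegrableOn hg₁ hφ.continuous hφc hφs
    have hi₂ := integrable_mul_of_locallyIntegrableOn hg₂ hφ.continuous hφc hφs
    rw [← sub_eq_zero, ← integral_sub hi₁ hi₂] at h'
    rw [← h']
    exact integral_congr_ae (Filter.Eventually.of_forall fun x => by simp; ring)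
  filter_upwards [this] with x hx hxΩ
  exact sub_eq_zero.1 (hx hxΩ)

/-! ### Fourier transforms of weak derivatives and the Sobolev norm. -/

/-- The Fourier transform of a real function on Euclidean space, in coordinates. -/
noncomputable def euclFourier {d : ℕ} (g : EuclideanSpace ℝ (Fin d) → ℝ) (ξ : Fin d → ℝ) : ℂ :=
  piFourier (fun x => (g (WithLp.toLp 2 x) : ℂ)) ξ

lemma integral_comp_toLp {d : ℕ} {E : Type*} [NormedAddCommGroup E] [NormedSpace ℝ E]
    (H : EuclideanSpace ℝ (Fin d) → E) :
    ∫ x : Fin d → ℝ, H (WithLp.toLp 2 x) = ∫ x, H x :=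
  (PiLp.volume_preserving_toLp (Fin d)).integral_comp
    (MeasurableEquiv.toLp 2 (Fin d → ℝ)).measurableEmbedding H

lemma lintegral_comp_toLp {d : ℕ} (H : EuclideanSpace ℝ (Fin d) → ENNReal) :
    ∫⁻ x : Fin d → ℝ, H (WithLp.toLp 2 x) = ∫⁻ x, H x :=
  (PiLp.volume_preserving_toLp (Fin d)).lintegral_comp_emb
    (MeasurableEquiv.toLp 2 (Fin d → ℝ)).measurableEmbedding H

lemma abs_cosWave_le {d : ℕ} (ξ : Fin d → ℝ) (θ : ℝ) (x : EuclideanSpace ℝ (Fin d)) :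
    |cosWave ξ θ x| ≤ 1 := Real.abs_cos_le_one _

lemma integrable_mul_cosWave {d : ℕ} {g : EuclideanSpace ℝ (Fin d) → ℝ} (hg : Integrable g)
    (ξ : Fin d → ℝ) (θ : ℝ) : Integrable fun x => g x * cosWave ξ θ x :=
  hg.mul_bdd (c := 1) (contDiff_cosWave ξ θ).continuous.aestronglyMeasurable
    (Filter.Eventually.of_forall fun x => abs_cosWave_le ξ θ x)

/-- The real and imaginary parts of a rotated Fourier transform are integrals against plane waves,
which carries real weak-derivative identities over to complex values. -/
lemma exp_mul_euclFourier {d : ℕ} {g : EuclideanSpace ℝ (Fin d) → ℝ} (hg : Integrable g)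
    (ξ : Fin d → ℝ) (θ : ℝ) :
    Complex.exp (θ * Complex.I) * euclFourier g ξ =
      ((∫ x, g x * cosWave ξ θ x : ℝ) : ℂ) +
        ((∫ x, g x * cosWave ξ (θ - Real.pi / 2) x : ℝ) : ℂ) * Complex.I := by
  rw [euclFourier, piFourier, ← integral_const_mul, ← integral_complex_ofReal,
    ← integral_complex_ofReal,
    ← integral_mul_const, ← integral_add]
  · rw [← integral_comp_toLp]
    refine integral_congr_ae (Filter.Eventually.of_forall fun x => ?_)
    simp only [cosWave, phase_eq_exp]
    rw [← mul_assoc, ← Complex.exp_add, sub_right_comm, Real.cos_sub_pi_div_two]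
    have : (θ : ℂ) * Complex.I + ((2 * Real.pi * -(x ⬝ᵥ ξ) : ℝ) : ℂ) * Complex.I =
        ((θ - 2 * Real.pi * (x ⬝ᵥ ξ) : ℝ) : ℂ) * Complex.I := by
      push_cast; ring
    rw [this, Complex.exp_mul_I]
    push_cast
    ring
  · exact (integrable_mul_cosWave hg ξ θ).ofReal
  · exact ((integrable_mul_cosWave hg ξ _).ofReal).mul_const _

/-- Testing a weak derivative of a function supported in the cube against plane waves. -/
lemma HasWeakDerivOn.integral_mul_cosWave {d : ℕ} {α : Fin d → ℕ}
    {f g : EuclideanSpace ℝ (Fin d) → ℝ} (h : HasWeakDerivOn Set.univ α f g)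
    (hf : tsupport f ⊆ unitCube d) (ξ : Fin d → ℝ) (θ : ℝ) :
    (∏ i, (2 * Real.pi * ξ i) ^ α i) *
      ∫ x, f x * cosWave ξ (θ - (∑ i, α i : ℕ) * (Real.pi / 2)) x =
      (-1) ^ (∑ i, α i) * ∫ x, g x * cosWave ξ θ x := by
  have hg0 := h.ae_eq_zero_of_notMem hf
  -- Plane waves lack compact support. The cutoff equals 1 on the ball of radius d + 1, which
  -- contains the cube, so neither integral changes.
  let χ : ContDiffBump (0 : EuclideanSpace ℝ (Fin d)) := ⟨d + 1, d + 2, by positivity, by linarith⟩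
  have hχ : ∀ x ∈ unitCube d, χ =ᶠ[nhds x] 1 := fun x hx =>
    χ.eventuallyEq_one_of_mem_ball (unitCube_subset_ball d hx)
  have hw := h.2.2 (fun x => χ x * cosWave ξ θ x) (χ.contDiff.mul (contDiff_cosWave ξ θ))
    χ.hasCompactSupport.mul_right (Set.subset_univ _)
  simp only [Measure.restrict_univ] at hw
  have h1 : ∫ x, g x * (χ x * cosWave ξ θ x) = ∫ x, g x * cosWave ξ θ x := by
    refine integral_congr_ae ?_
    filter_upwards [hg0] with x hx
    by_cases hxc : x ∈ unitCube d
    · simp [(hχ x hxc).eq_of_nhds]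
    · simp [hx hxc]
  rw [h1] at hw
  rw [← hw, ← integral_const_mul]
  refine integral_congr_ae (Filter.Eventually.of_forall fun x => ?_)
  by_cases hxc : x ∈ unitCube d
  · have h2 : (fun x => χ x * cosWave ξ θ x) =ᶠ[nhds x] cosWave ξ θ := by
      filter_upwards [hχ x hxc] with y hy
      simp [hy]
    have h3 := (multiDeriv_congr α h2).eq_of_nhds
    simp only [h3, multiDeriv_cosWave]
    ring
  · have : f x = 0 := image_eq_zero_of_notMem_tsupport fun h' => hxc (hf h')
    simp [this]

/-- The phases 0 and -π/2 give the two parts of one complex identity; its unimodular factors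
disappear in the norm. -/
lemma HasWeakDerivOn.norm_euclFourier {d : ℕ} {α : Fin d → ℕ}
    {f g : EuclideanSpace ℝ (Fin d) → ℝ} (h : HasWeakDerivOn Set.univ α f g)
    (hf : tsupport f ⊆ unitCube d) (hfi : Integrable f) (hgi : Integrable g) (ξ : Fin d → ℝ) :
    ‖euclFourier g ξ‖ = (∏ i, (2 * Real.pi * |ξ i|) ^ α i) * ‖euclFourier f ξ‖ := by
  set c : ℝ := ∏ i, (2 * Real.pi * ξ i) ^ α i with hc
  set a : ℕ := ∑ i, α i with ha
  have hθ := fun θ : ℝ => h.integral_mul_cosWave hf ξ θ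
  have h1 := exp_mul_euclFourier hgi ξ 0
  have h2 := exp_mul_euclFourier hfi ξ (0 - a * (Real.pi / 2))
  have h3 : ((-1) ^ a : ℂ) * (Complex.exp ((0 : ℝ) * Complex.I) * euclFourier g ξ) =
      c * (Complex.exp ((0 - a * (Real.pi / 2) : ℝ) * Complex.I) * euclFourier f ξ) := by
    rw [h1, h2, mul_add, mul_add, ← mul_assoc, ← mul_assoc, sub_right_comm]
    have e1 := congrArg (fun t : ℝ => (t : ℂ)) (hθ 0)
    have e2 := congrArg (fun t : ℝ => (t : ℂ)) (hθ (0 - Real.pi / 2))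
    simp only [Complex.ofReal_mul, Complex.ofReal_pow, Complex.ofReal_neg, Complex.ofReal_one]
      at e1 e2
    rw [← e1, ← e2]
  have h4 := congrArg norm h3
  simp only [norm_mul, norm_pow, norm_neg, norm_one, one_pow, one_mul, Complex.norm_exp_ofReal_mul_I,
    Complex.norm_real, Real.norm_eq_abs] at h4
  rw [h4, hc, Finset.abs_prod]
  congr 1
  refine Finset.prod_congr rfl fun i _ => ?_
  rw [abs_pow, abs_mul, abs_of_pos (by positivity : (0 : ℝ) < 2 * Real.pi)]

lemma integrable_of_memLp_of_ae_eq_zero {d : ℕ} {g : EuclideanSpace ℝ (Fin d) → ℝ}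
    (hg : MemLp g 2) (h0 : ∀ᵐ x, x ∉ unitCube d → g x = 0) : Integrable g := by
  have : IsFiniteMeasure (volume.restrict (unitCube d)) :=
    ⟨by simpa using volume_unitCube_lt_top d⟩
  have : IntegrableOn g (unitCube d) := (hg.restrict _).integrable one_le_two
  exact this.integrable_of_ae_notMem_eq_zero h0

/-- Plancherel's identity for functions supported in the unit cube. -/
lemma lintegral_sq_norm_euclFourier {d : ℕ} {g : EuclideanSpace ℝ (Fin d) → ℝ}
    (hg : MemLp g 2) (h0 : ∀ᵐ x, x ∉ unitCube d → g x = 0) :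
    ∫⁻ ξ, ‖euclFourier g ξ‖ₑ ^ 2 = ∫⁻ x in openUnitCube d, ‖g x‖ₑ ^ 2 := by
  have hmp := PiLp.volume_preserving_toLp (Fin d)
  have hL : MemLp (fun x : Fin d → ℝ => (g (WithLp.toLp 2 x) : ℂ)) 2 :=
    (hg.comp_measurePreserving hmp).ofReal
  have hI : Integrable (fun x : Fin d → ℝ => (g (WithLp.toLp 2 x) : ℂ)) :=
    (hmp.integrable_comp_of_integrable (integrable_of_memLp_of_ae_eq_zero hg h0)).ofReal
  have h0' : ∀ᵐ x, x ∉ openUnitCube d → g x = 0 := by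
    filter_upwards [h0, ae_unitCube_imp_openUnitCube d] with x h1 h2 h3
    exact h1 fun h => h3 (h2 h)
  have hs : ∀ᵐ x : Fin d → ℝ, x ∉ iocCube d → (g (WithLp.toLp 2 x) : ℂ) = 0 := by
    filter_upwards [hmp.quasiMeasurePreserving.ae h0'] with x hx hxc
    rw [hx fun h => hxc fun i => ⟨(h i).1, (h i).2.le⟩, Complex.ofReal_zero]
  have h1 := lintegral_sq_norm_piFourier hL hI hs
  have h2 : ∀ t : ℝ, ‖(t : ℂ)‖ₑ = ‖t‖ₑ := fun t => by
    rw [← ofReal_norm, ← ofReal_norm, Complex.norm_real]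
  simp only [h2] at h1
  rw [lintegral_comp_toLp fun x => ‖g x‖ₑ ^ 2] at h1
  rw [← lintegral_indicator (isOpen_openUnitCube d).measurableSet]
  refine h1.trans (lintegral_congr_ae ?_)
  filter_upwards [h0'] with x hx
  by_cases hxc : x ∈ openUnitCube d
  · rw [Set.indicator_of_mem hxc]
  · rw [Set.indicator_of_notMem hxc, hx hxc]
    simp

lemma MemHMixZero.integrable {d r : ℕ} {f : EuclideanSpace ℝ (Fin d) → ℝ} (hf : MemHMixZero r f) :
    Integrable f :=
  integrable_of_memLp_of_ae_eq_zero (by simpa using hf.memHMix.1)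
    (Filter.Eventually.of_forall fun x hx =>
      image_eq_zero_of_notMem_tsupport fun h => hx (hf.tsupport_subset h))

lemma MemHMixZero.hasCompactSupport {d r : ℕ} {f : EuclideanSpace ℝ (Fin d) → ℝ}
    (hf : MemHMixZero r f) : HasCompactSupport f := by
  refine Metric.isCompact_of_isClosed_isBounded (isClosed_tsupport f) ?_
  exact (Metric.isBounded_ball.subset (unitCube_subset_ball d)).subset hf.tsupport_subset

lemma MemHMixZero.lintegral_euclFourier {d r : ℕ} {f : EuclideanSpace ℝ (Fin d) → ℝ}
    (hf : MemHMixZero r f) {α : Fin d → ℕ} (hα : ∀ i, α i ≤ r) :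
    ∫⁻ ξ, ENNReal.ofReal ((∏ i, (2 * Real.pi * |ξ i|) ^ α i) ^ 2) * ‖euclFourier f ξ‖ₑ ^ 2 =
      ENNReal.ofReal (∫ x in openUnitCube d, weakDeriv (openUnitCube d) α f x ^ 2) := by
  obtain ⟨g, hg, hgL⟩ := hf.memHMix.2 α hα
  rw [Measure.restrict_univ] at hgL
  have h0 := hg.ae_eq_zero_of_notMem hf.tsupport_subset
  have hgi := integrable_of_memLp_of_ae_eq_zero hgL h0
  have hex : ∃ g, HasWeakDerivOn (openUnitCube d) α f g := ⟨g, hg.mono⟩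
  have hwd : HasWeakDerivOn (openUnitCube d) α f (weakDeriv (openUnitCube d) α f) := by
    rw [weakDeriv, dif_pos hex]
    exact hex.choose_spec
  have hae := hwd.ae_eq (isOpen_openUnitCube d) hg.mono
  have h1 : ∫ x in openUnitCube d, weakDeriv (openUnitCube d) α f x ^ 2 =
      ∫ x in openUnitCube d, g x ^ 2 := by
    refine setIntegral_congr_ae (isOpen_openUnitCube d).measurableSet ?_
    filter_upwards [hae] with x hx hxc
    rw [hx hxc]
  have h2 : ∀ t : ℝ, ENNReal.ofReal (t ^ 2) = ‖t‖ₑ ^ 2 := fun t => by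
    rw [← sq_abs, ENNReal.ofReal_pow (abs_nonneg _), ← Real.norm_eq_abs, ofReal_norm]
  rw [h1, ofReal_integral_eq_lintegral_ofReal hgL.integrable_sq.integrableOn
    (Filter.Eventually.of_forall fun x => sq_nonneg _)]
  simp only [h2]
  rw [← lintegral_sq_norm_euclFourier hgL h0]
  refine lintegral_congr fun ξ => ?_
  rw [← ofReal_norm (euclFourier g ξ),
    hg.norm_euclFourier hf.tsupport_subset hf.integrable hgi, ENNReal.ofReal_mul (by positivity),
    ofReal_norm, mul_pow, Real.enorm_eq_ofReal (by positivity)]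

/-- The weighted square integral of the Fourier transform is bounded by the Sobolev norm. -/
theorem MemHMixZero.lintegral_maxProd_euclFourier_le {d r : ℕ}
    {f : EuclideanSpace ℝ (Fin d) → ℝ} (hf : MemHMixZero r f) :
    ∫⁻ ξ, ENNReal.ofReal (maxProd ξ ^ (2 * r)) * ‖euclFourier f ξ‖ₑ ^ 2 ≤
      ENNReal.ofReal (normHMix r (openUnitCube d) f ^ 2) := by
  set S := Fintype.piFinset (fun _ : Fin d => Finset.range (r + 1)) with hS
  have hpt : ∀ ξ : Fin d → ℝ, maxProd ξ ^ (2 * r) ≤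
      ∑ α ∈ S, (∏ i, (2 * Real.pi * |ξ i|) ^ α i) ^ 2 := by
    intro ξ
    -- The term k = 0 suffices for |ξ_i| ≤ 1 and k = r for |ξ_i| ≥ 1. Expanding the product of these
    -- sums produces exactly the multi-indices in {0,…,r}^d.
    have h1 : ∀ i, max 1 |ξ i| ^ (2 * r) ≤
        ∑ k ∈ Finset.range (r + 1), ((2 * Real.pi * |ξ i|) ^ k) ^ 2 := by
      intro i
      rcases le_total |ξ i| 1 with h | h
      · rw [max_eq_left h, one_pow]
        have := Finset.single_le_sum (f := fun k => ((2 * Real.pi * |ξ i|) ^ k) ^ 2)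
          (fun k _ => sq_nonneg _) (Finset.mem_range.2 (Nat.succ_pos r))
        simpa using this
      · rw [max_eq_right h]
        have := Finset.single_le_sum (f := fun k => ((2 * Real.pi * |ξ i|) ^ k) ^ 2)
          (fun k _ => sq_nonneg _) (Finset.mem_range.2 (Nat.lt_succ_self r))
        refine le_trans ?_ this
        rw [← pow_mul, mul_comm r 2]
        gcongr
        have := Real.pi_gt_three
        nlinarith [abs_nonneg (ξ i)]
    calc maxProd ξ ^ (2 * r) = ∏ i, max 1 |ξ i| ^ (2 * r) := by rw [maxProd, Finset.prod_pow]
      _ ≤ ∏ i, ∑ k ∈ Finset.range (r + 1), ((2 * Real.pi * |ξ i|) ^ k) ^ 2 :=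
        Finset.prod_le_prod (fun i _ => by positivity) fun i _ => h1 i
      _ = ∑ α ∈ S, ∏ i, ((2 * Real.pi * |ξ i|) ^ α i) ^ 2 := Finset.prod_univ_sum _ _
      _ = ∑ α ∈ S, (∏ i, (2 * Real.pi * |ξ i|) ^ α i) ^ 2 := by simp_rw [Finset.prod_pow]
  have hcont : Continuous (euclFourier f) := by
    refine continuous_piFourier ?_
    exact ((PiLp.volume_preserving_toLp (Fin d)).integrable_comp_of_integrable hf.integrable).ofReal
  have hmeas : ∀ α : Fin d → ℕ, Measurable fun ξ : Fin d → ℝ =>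
      ENNReal.ofReal ((∏ i, (2 * Real.pi * |ξ i|) ^ α i) ^ 2) * ‖euclFourier f ξ‖ₑ ^ 2 := fun α =>
    Measurable.mul (by fun_prop) (hcont.measurable.enorm.pow_const 2)
  calc ∫⁻ ξ, ENNReal.ofReal (maxProd ξ ^ (2 * r)) * ‖euclFourier f ξ‖ₑ ^ 2
      ≤ ∫⁻ ξ, ∑ α ∈ S, ENNReal.ofReal ((∏ i, (2 * Real.pi * |ξ i|) ^ α i) ^ 2) *
          ‖euclFourier f ξ‖ₑ ^ 2 := by
        refine lintegral_mono fun ξ => ?_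
        rw [← Finset.sum_mul, ← ENNReal.ofReal_sum_of_nonneg fun _ _ => sq_nonneg _]
        exact mul_le_mul_left (ENNReal.ofReal_le_ofReal (hpt ξ)) _
    _ = ∑ α ∈ S, ENNReal.ofReal (∫ x in openUnitCube d, weakDeriv (openUnitCube d) α f x ^ 2) := by
        rw [lintegral_finsetSum _ fun α _ => hmeas α]
        refine Finset.sum_congr rfl fun α hα => hf.lintegral_euclFourier fun i => ?_
        exact Nat.lt_succ_iff.1 (Finset.mem_range.1 (Fintype.mem_piFinset.1 hα i))
    _ = ENNReal.ofReal (normHMix r (openUnitCube d) f ^ 2) := by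
        rw [normHMix, Real.sq_sqrt (Finset.sum_nonneg fun α _ =>
          integral_nonneg fun x => sq_nonneg _), ENNReal.ofReal_sum_of_nonneg]
        exact fun α _ => integral_nonneg fun x => sq_nonneg _

/-! ### The error of a lattice rule. -/

lemma integral_comp_mulVec {d : ℕ} {A : Matrix (Fin d) (Fin d) ℝ} (hA : A.det ≠ 0)
    (Φ : (Fin d → ℝ) → ℂ) : ∫ y, Φ (A *ᵥ y) = |A.det|⁻¹ * ∫ x, Φ x := by
  have h := Real.map_matrix_volume_pi_eq_smul_volume_pi hA
  have hemb : MeasurableEmbedding (Matrix.toLin' A) := by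
    have hinj : Function.Injective (Matrix.toLin' A) := by
      have := (Matrix.isUnit_iff_isUnit_det A).2 hA.isUnit
      exact Matrix.mulVec_injective_of_isUnit this
    exact (LinearMap.isClosedEmbedding_of_injective
      (LinearMap.ker_eq_bot.2 hinj)).measurableEmbedding
  have h2 := hemb.integral_map (μ := volume) Φ
  rw [h, integral_smul_measure] at h2
  simp only [Matrix.toLin'_apply] at h2
  rw [← h2, abs_inv, ENNReal.toReal_ofReal (by positivity), Complex.real_smul]

lemma hasCompactSupport_comp_mulVec {d : ℕ} {f : EuclideanSpace ℝ (Fin d) → ℝ}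
    (hc : HasCompactSupport f) {S : Matrix (Fin d) (Fin d) ℝ} (hS : IsUnit S.det) :
    HasCompactSupport fun y : Fin d → ℝ => f (WithLp.toLp 2 ((S⁻¹)ᵀ *ᵥ y)) := by
  have hcont : Continuous fun x : EuclideanSpace ℝ (Fin d) => Sᵀ *ᵥ x.ofLp := by fun_prop
  refine HasCompactSupport.intro (hc.isCompact.image hcont) fun y hy => ?_
  refine image_eq_zero_of_notMem_tsupport fun h => hy ⟨_, h, ?_⟩
  simp only [Matrix.mulVec_mulVec]
  rw [← Matrix.transpose_mul, Matrix.nonsing_inv_mul _ hS, Matrix.transpose_one, Matrix.one_mulVec]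

/-- The inverse transpose is dual to S: S^{-⊤}y · Sξ = y · ξ. The factor |det S| cancels the
normalization of `latticeRule`. -/
lemma piFourier_comp_mulVec {d : ℕ} (f : EuclideanSpace ℝ (Fin d) → ℝ)
    {S : Matrix (Fin d) (Fin d) ℝ} (hS : IsUnit S.det) (ξ : Fin d → ℝ) :
    piFourier (fun y => (f (WithLp.toLp 2 ((S⁻¹)ᵀ *ᵥ y)) : ℂ)) ξ =
      |S.det| * euclFourier f (S *ᵥ ξ) := by
  have hA : (S⁻¹)ᵀ.det ≠ 0 := by
    rw [Matrix.det_transpose, Matrix.det_nonsing_inv, Ring.inverse_eq_inv]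
    exact inv_ne_zero hS.ne_zero
  have h := integral_comp_mulVec hA
    fun x => phase (-(x ⬝ᵥ S *ᵥ ξ)) * (f (WithLp.toLp 2 x) : ℂ)
  have hdot : ∀ y : Fin d → ℝ, ((S⁻¹)ᵀ *ᵥ y) ⬝ᵥ S *ᵥ ξ = y ⬝ᵥ ξ := fun y => by
    rw [Matrix.mulVec_transpose, ← Matrix.dotProduct_mulVec, Matrix.mulVec_mulVec,
      Matrix.nonsing_inv_mul _ hS, Matrix.one_mulVec]
  simp only [hdot] at h
  rw [piFourier, h, Matrix.det_transpose, Matrix.det_nonsing_inv, Ring.inverse_eq_inv, abs_inv,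
    inv_inv]
  rfl

lemma euclFourier_zero {d : ℕ} (f : EuclideanSpace ℝ (Fin d) → ℝ) :
    euclFourier f 0 = ((∫ x, f x : ℝ) : ℂ) := by
  rw [euclFourier, piFourier, ← integral_complex_ofReal, ← integral_comp_toLp]
  simp [phase_eq_exp]

/-- The error of a lattice rule is bounded by the sum of the Fourier transform over the dual
lattice without the origin. -/
theorem enorm_latticeRule_sub_integral_le {d : ℕ} {f : EuclideanSpace ℝ (Fin d) → ℝ}
    (hf : Continuous f) (hc : HasCompactSupport f) {S : Matrix (Fin d) (Fin d) ℝ}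
    (hS : IsUnit S.det) (v : Fin d → ℝ) :
    ‖latticeRule S v f - ∫ x, f x‖ₑ ≤
      ∑' k : Fin d → ℤ, if k = 0 then 0 else ‖euclFourier f (S *ᵥ intVec k)‖ₑ := by
  set D : ℝ := |S.det| with hD
  have hD0 : 0 < D := abs_pos.2 hS.ne_zero
  set a : (Fin d → ℤ) → ℂ := fun k => euclFourier f (S *ᵥ intVec k) with ha
  have hite : ∀ k, (if k = 0 then 0 else ‖a k‖ₑ) = ‖if k = 0 then 0 else a k‖ₑ := fun k => by
    split_ifs <;> simp
  change _ ≤ ∑' k, if k = 0 then 0 else ‖a k‖ₑ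
  simp only [hite]
  -- An infinite bound is trivial; a finite one is precisely the summability that Poisson summation
  -- needs.
  by_cases htop : ∑' k, ‖if k = 0 then 0 else a k‖ₑ = ⊤
  · rw [htop]; exact le_top
  have hsum : Summable fun k => ‖if k = 0 then 0 else a k‖ := by
    have := ENNReal.summable_toReal htop
    simpa using this
  have ha0 : Summable fun k : Fin d → ℤ => if k = 0 then a 0 else 0 :=
    summable_of_ne_finset_zero (s := {0}) fun k hk => by simp_all
  have hasum : Summable a := by
    have := hsum.of_norm.add ha0
    refine this.congr fun k => ?_
    by_cases hk : k = 0 <;> simp [hk]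
  set h : (Fin d → ℝ) → ℂ := fun y => (f (WithLp.toLp 2 ((S⁻¹)ᵀ *ᵥ y)) : ℂ) with hh
  have hhc : Continuous h := by
    have : Continuous fun y : Fin d → ℝ => WithLp.toLp 2 ((S⁻¹)ᵀ *ᵥ y) := by fun_prop
    exact Complex.continuous_ofReal.comp (hf.comp this)
  have hhs : HasCompactSupport h :=
    (hasCompactSupport_comp_mulVec hc hS).comp_left Complex.ofReal_zero
  have hcoef : ∀ k, piFourier h (intVec k) = D * a k := fun k => piFourier_comp_mulVec f hS _
  have hP := hasSum_poisson_summation hhc hhs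
    (by simpa only [hcoef] using hasum.mul_left (D : ℂ)) v
  simp only [hcoef] at hP
  have hQ : ((latticeRule S v f : ℝ) : ℂ) = (D : ℂ)⁻¹ * ∑' m : Fin d → ℤ, h (v + intVec m) := by
    rw [latticeRule, Complex.ofReal_mul, Complex.ofReal_tsum, Complex.ofReal_inv]
    congr 1
    refine tsum_congr fun m => ?_
    have : v + intVec m = fun i => (m i : ℝ) + v i := by
      funext i; simp [intVec, add_comm]
    simp only [hh, this]
  have hQ' : HasSum (fun k => a k * phase (v ⬝ᵥ intVec k)) (latticeRule S v f : ℂ) := by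
    rw [hQ]
    convert! hP.mul_left (D : ℂ)⁻¹ using 2 with k
    have : (D : ℂ) ≠ 0 := by exact_mod_cast hD0.ne'
    field_simp
  have hI : HasSum (fun k : Fin d → ℤ => if k = 0 then a 0 else 0) ((∫ x, f x : ℝ) : ℂ) := by
    have h0 : a 0 = ((∫ x, f x : ℝ) : ℂ) := by
      have : intVec (0 : Fin d → ℤ) = 0 := by funext i; simp [intVec]
      rw [ha, ← euclFourier_zero]
      simp [this]
    rw [← h0]
    exact hasSum_ite_eq 0 (a 0)
  have hdiff := hQ'.sub hI
  rw [← Complex.ofReal_sub] at hdiff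
  have hn : ∀ t : ℝ, ‖t‖ₑ = ‖(t : ℂ)‖ₑ := fun t => by
    rw [← ofReal_norm, ← ofReal_norm, Complex.norm_real]
  have hterm : ∀ k, ‖a k * phase (v ⬝ᵥ intVec k) - (if k = 0 then a 0 else 0)‖ₑ =
      ‖if k = 0 then 0 else a k‖ₑ := by
    intro k
    by_cases hk : k = 0
    · subst hk
      have : intVec (0 : Fin d → ℤ) = 0 := by funext i; simp [intVec]
      simp [this, phase_eq_exp]
    · simp only [if_neg hk, sub_zero]
      rw [← ofReal_norm, ← ofReal_norm, norm_mul, norm_phase, mul_one]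
  rw [hn, ← hdiff.tsum_eq, ← tsum_congr hterm]
  exact enorm_tsum_le_tsum_enorm

/-! ### The expected error. -/

lemma volume_dilationBox (d : ℕ) : volume (dilationBox d) ≠ 0 ∧ volume (dilationBox d) ≠ ⊤ := by
  have h : dilationBox d = Set.univ.pi fun _ => Set.Icc (1 : ℝ) (2 ^ (1 / (d : ℝ))) := by
    ext x
    exact ⟨fun h i _ => h i, fun h i => h i trivial⟩
  rw [h, volume_pi_pi]
  refine ⟨?_, ENNReal.prod_ne_top fun i _ => by simp⟩
  refine Finset.prod_ne_zero_iff.2 fun i _ => ?_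
  have hd : (0 : ℝ) < d := by exact_mod_cast i.pos
  rw [Real.volume_Icc, ne_eq, ENNReal.ofReal_eq_zero, not_le, sub_pos]
  exact Real.one_lt_rpow (by norm_num) (by positivity)

lemma dilatedMatrix_mulVec {d n : ℕ} (u : Fin d → ℝ) (B : Matrix (Fin d) (Fin d) ℝ)
    (x : Fin d → ℝ) :
    dilatedMatrix n u B *ᵥ x = ((n : ℝ) ^ (1 / (d : ℝ))) • (B *ᵥ x) * u := by
  funext i
  rw [dilatedMatrix, Matrix.smul_mulVec, ← Matrix.mulVec_mulVec]
  simp only [Pi.smul_apply, Pi.mul_apply, Matrix.mulVec_diagonal, smul_eq_mul]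
  ring

lemma isUnit_det_dilatedMatrix {d n : ℕ} (hn : n ≠ 0) {u : Fin d → ℝ} (hu : u ∈ dilationBox d)
    {B : Matrix (Fin d) (Fin d) ℝ} (hB : IsUnit B) : IsUnit (dilatedMatrix n u B).det := by
  have hn0 : (0 : ℝ) < n := by exact_mod_cast hn.bot_lt
  rw [dilatedMatrix, Matrix.det_smul, Matrix.det_mul, Matrix.det_diagonal, isUnit_iff_ne_zero]
  refine mul_ne_zero (pow_ne_zero _ (Real.rpow_pos_of_pos hn0 _).ne') (mul_ne_zero ?_ ?_)
  · exact Finset.prod_ne_zero_iff.2 fun i _ => (zero_lt_one.trans_le (hu i).1).ne'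
  · exact ((Matrix.isUnit_iff_isUnit_det B).1 hB).ne_zero

/-- The inverse is a determinant inverse times the adjugate, so each term is measurable in u. On the
box the matrix is invertible and the series finite, so the rule is there a limit of partial sums. -/
lemma aemeasurable_latticeRule {d n : ℕ} (hn : n ≠ 0) {B : Matrix (Fin d) (Fin d) ℝ}
    (hB : IsUnit B) (v : Fin d → ℝ) {f : EuclideanSpace ℝ (Fin d) → ℝ} (hf : Continuous f)
    (hc : HasCompactSupport f) :
    AEMeasurable (fun u => latticeRule (dilatedMatrix n u B) v f)
      (volume.restrict (dilationBox d)) := by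
  have hS : Continuous fun u : Fin d → ℝ => dilatedMatrix n u B := by
    unfold dilatedMatrix
    fun_prop
  let G : (Fin d → ℤ) → (Fin d → ℝ) → ℝ := fun m u =>
    f (WithLp.toLp 2 (((dilatedMatrix n u B)⁻¹)ᵀ *ᵥ fun i => (m i : ℝ) + v i))
  have hterm : ∀ m : Fin d → ℤ, Measurable (G m) := by
    intro m
    have h1 : Measurable fun u : Fin d → ℝ => (dilatedMatrix n u B).det⁻¹ :=
      hS.matrix_det.measurable.inv
    have h2 : Measurable fun u : Fin d → ℝ =>
        ((dilatedMatrix n u B).adjugate)ᵀ *ᵥ fun i => (m i : ℝ) + v i :=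
      (hS.matrix_adjugate.matrix_transpose.matrix_mulVec continuous_const).measurable
    have h3 : (fun u : Fin d → ℝ => ((dilatedMatrix n u B)⁻¹)ᵀ *ᵥ fun i => (m i : ℝ) + v i) =
        fun u => (dilatedMatrix n u B).det⁻¹ •
          (((dilatedMatrix n u B).adjugate)ᵀ *ᵥ fun i => (m i : ℝ) + v i) := by
      funext u
      rw [Matrix.inv_def, Ring.inverse_eq_inv, Matrix.transpose_smul, Matrix.smul_mulVec]
    have h4 := h1.smul h2
    have h5 : Measurable fun u : Fin d → ℝ =>
        ((dilatedMatrix n u B)⁻¹)ᵀ *ᵥ fun i => (m i : ℝ) + v i := by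
      rw [h3]
      exact h4
    exact hf.measurable.comp ((PiLp.continuous_toLp 2 _).measurable.comp h5)
  refine AEMeasurable.mul ?_ ?_
  · exact (hS.matrix_det.abs.measurable.inv).aemeasurable
  · refine aemeasurable_of_tendsto_metrizable_ae (Filter.atTop : Filter (Finset (Fin d → ℤ)))
      (f := fun T u => ∑ m ∈ T, G m u)
      (fun T => (Finset.measurable_fun_sum T fun m _ => hterm m).aemeasurable) ?_
    filter_upwards [ae_restrict_mem (measurableSet_dilationBox d)] with u hu
    obtain ⟨T, hT⟩ := exists_finset_forall_notMem_eq_zero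
      (hasCompactSupport_comp_mulVec hc (isUnit_det_dilatedMatrix hn hu hB)) ‖v‖
    suffices hsum : Summable fun m => G m u from hsum.hasSum
    refine summable_of_ne_finset_zero (s := T) fun m hm => ?_
    have : (fun i => (m i : ℝ) + v i) = v + intVec m := by
      funext i; simp [intVec, add_comm]
    simp only [G, this]
    exact hT v le_rfl m hm

/-- Cauchy–Schwarz bound for the `L¹` norm of the Fourier transform off a hyperbolic cross. -/
lemma lintegral_tail_le {d r : ℕ} {F : (Fin d → ℝ) → ℂ} (hF : Continuous F) (t : ℝ) :
    ∫⁻ x, (if t ≤ maxProd x then ‖F x‖ₑ else 0) ≤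
      (∫⁻ x, ENNReal.ofReal (maxProd x ^ (2 * r)) * ‖F x‖ₑ ^ 2) ^ (1 / 2 : ℝ) *
        (crossTail r d t) ^ (1 / 2 : ℝ) := by
  have hm1 : Measurable fun x : Fin d → ℝ => ENNReal.ofReal (maxProd x ^ r) * ‖F x‖ₑ :=
    (measurable_maxProd.pow_const r).ennreal_ofReal.mul hF.measurable.enorm
  have hm2 : Measurable fun x : Fin d → ℝ =>
      if t ≤ maxProd x then ENNReal.ofReal ((maxProd x ^ r)⁻¹) else 0 :=
    Measurable.ite (measurableSet_le measurable_const measurable_maxProd)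
      ((measurable_maxProd.pow_const _).inv.ennreal_ofReal) measurable_const
  have h := ENNReal.lintegral_mul_le_Lp_mul_Lq volume Real.HolderConjugate.two_two
    hm1.aemeasurable hm2.aemeasurable
  have hpos : ∀ x : Fin d → ℝ, 0 < maxProd x := fun x => zero_lt_one.trans_le (one_le_maxProd x)
  have e1 : ∀ x : Fin d → ℝ, (if t ≤ maxProd x then ‖F x‖ₑ else 0) =
      ((fun x : Fin d → ℝ => ENNReal.ofReal (maxProd x ^ r) * ‖F x‖ₑ) * fun x : Fin d → ℝ =>
        if t ≤ maxProd x then ENNReal.ofReal ((maxProd x ^ r)⁻¹) else 0) x := fun x => by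
    simp only [Pi.mul_apply]
    have := hpos x
    split_ifs
    · rw [mul_right_comm, ← ENNReal.ofReal_mul (by positivity), mul_inv_cancel₀ (by positivity),
        ENNReal.ofReal_one, one_mul]
    · rw [mul_zero]
  have e2 : ∀ x : Fin d → ℝ, (ENNReal.ofReal (maxProd x ^ r) * ‖F x‖ₑ) ^ (2 : ℝ) =
      ENNReal.ofReal (maxProd x ^ (2 * r)) * ‖F x‖ₑ ^ 2 := fun x => by
    have := hpos x
    rw [ENNReal.rpow_two, mul_pow, ← ENNReal.ofReal_pow (by positivity), ← pow_mul, mul_comm r 2]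
  have e3 : ∀ x : Fin d → ℝ,
      (if t ≤ maxProd x then ENNReal.ofReal ((maxProd x ^ r)⁻¹) else 0) ^ (2 : ℝ) =
      if t ≤ maxProd x then ENNReal.ofReal ((maxProd x ^ (2 * r))⁻¹) else 0 := fun x => by
    have := hpos x
    split_ifs
    · rw [ENNReal.rpow_two, ← ENNReal.ofReal_pow (by positivity), inv_pow, ← pow_mul, mul_comm r 2]
    · simp
  simp only [e2, e3] at h
  simp only [e1]
  exact h

/-- The expected error of the randomly dilated lattice rule, before inserting the decay of the
tail integral. -/
lemma lintegral_dilationBox_error_le {d r n : ℕ} (hd : 1 ≤ d) (hn : n ≠ 0)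
    {B : Matrix (Fin d) (Fin d) ℝ} (hB : IsFrolovMatrix B) (v : Fin d → ℝ)
    {f : EuclideanSpace ℝ (Fin d) → ℝ} (hf : MemHMixZero r f) :
    ∫⁻ u in dilationBox d, ‖latticeRule (dilatedMatrix n u B) v f - ∫ x, f x‖ₑ ≤
      ENNReal.ofReal (4 / n) * (ENNReal.ofReal (normHMix r (openUnitCube d) f) *
        (crossTail r d n) ^ (1 / 2 : ℝ)) := by
  set ν : ℝ := (n : ℝ) ^ (1 / (d : ℝ)) with hν
  have hn0 : (0 : ℝ) < n := by exact_mod_cast hn.bot_lt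
  have hν0 : 0 < ν := Real.rpow_pos_of_pos hn0 _
  have hνd : ν ^ d = n := by
    rw [hν, one_div]
    exact Real.rpow_inv_natCast_pow hn0.le (by omega)
  have hcont : Continuous (euclFourier f) := by
    refine continuous_piFourier ?_
    exact ((PiLp.volume_preserving_toLp (Fin d)).integrable_comp_of_integrable hf.integrable).ofReal
  have hmeas : Measurable fun ξ => ‖euclFourier f ξ‖ₑ := hcont.measurable.enorm
  have hpt : ∀ u ∈ dilationBox d, ‖latticeRule (dilatedMatrix n u B) v f - ∫ x, f x‖ₑ ≤
      ∑' k : Fin d → ℤ, if k = 0 then 0 else ‖euclFourier f (ν • (B *ᵥ intVec k) * u)‖ₑ := by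
    intro u hu
    have := enorm_latticeRule_sub_integral_le hf.continuous hf.hasCompactSupport
      (isUnit_det_dilatedMatrix hn hu hB.invertible) v
    simpa only [dilatedMatrix_mulVec] using this
  have hterm : ∀ k : Fin d → ℤ, Measurable fun u : Fin d → ℝ =>
      if k = 0 then 0 else ‖euclFourier f (ν • (B *ᵥ intVec k) * u)‖ₑ := fun k => by
    by_cases hk : k = 0
    · simp [hk]
    · simp only [if_neg hk]
      exact hmeas.comp (measurable_const_mul _)
  have hnorm : 0 ≤ normHMix r (openUnitCube d) f := Real.sqrt_nonneg _
  calc ∫⁻ u in dilationBox d, ‖latticeRule (dilatedMatrix n u B) v f - ∫ x, f x‖ₑ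
      ≤ ∫⁻ u in dilationBox d, ∑' k : Fin d → ℤ,
          if k = 0 then 0 else ‖euclFourier f (ν • (B *ᵥ intVec k) * u)‖ₑ :=
        setLIntegral_mono' (measurableSet_dilationBox d) hpt
    _ = ∑' k : Fin d → ℤ, (if k = 0 then 0 else
          ∫⁻ u in dilationBox d, ‖euclFourier f (ν • (B *ᵥ intVec k) * u)‖ₑ) := by
        rw [lintegral_tsum fun k => (hterm k).aemeasurable]
        refine tsum_congr fun k => ?_
        split_ifs <;> simp
    _ ≤ ENNReal.ofReal (4 / ν ^ d) *
          ∫⁻ x, if ν ^ d ≤ maxProd x then ‖euclFourier f x‖ₑ else 0 :=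
        hB.tsum_lintegral_dilationBox_le hd hν0 hmeas
    _ ≤ _ := by
        rw [hνd]
        refine mul_le_mul_right ((lintegral_tail_le (r := r) hcont n).trans ?_) _
        refine mul_le_mul_left ?_ _
        refine (ENNReal.rpow_le_rpow hf.lintegral_maxProd_euclFourier_le (by norm_num)).trans ?_
        rw [ENNReal.ofReal_rpow_of_nonneg (sq_nonneg _) (by norm_num), ← Real.sqrt_eq_rpow,
          Real.sqrt_sq hnorm]

/-- For n ≥ 2, log n ≥ log 2 > 1/2, hence 1 + log n ≤ 3 log n; this is the origin of the 3. -/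
lemma sqrt_crossTail_bound {d r : ℕ} (hd : 1 ≤ d) (hr : 1 ≤ r) {C : ℝ} (hC : 0 < C) {n : ℕ}
    (hn : 2 ≤ n) :
    4 / n * √(C * ((n : ℝ) ^ (2 * r - 1))⁻¹ * (1 + Real.log n) ^ (d - 1)) ≤
      4 * √C * 3 ^ (((d : ℝ) - 1) / 2) * (n : ℝ) ^ (-(r : ℝ) - 1 / 2) *
        Real.log n ^ (((d : ℝ) - 1) / 2) := by
  have hn2 : (2 : ℝ) ≤ n := by exact_mod_cast hn
  have hn0 : (0 : ℝ) < n := by linarith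
  have hlog2 := Real.log_two_gt_d9
  have hlog : Real.log 2 ≤ Real.log n := Real.log_le_log (by norm_num) hn2
  have hlog0 : 0 < Real.log n := by linarith
  have h1 : √((1 + Real.log n) ^ (d - 1)) ≤
      3 ^ (((d : ℝ) - 1) / 2) * Real.log n ^ (((d : ℝ) - 1) / 2) := by
    have h2 : (1 + Real.log n) ^ (d - 1) ≤ (3 * Real.log n) ^ (d - 1) := by
      gcongr
      linarith
    refine (Real.sqrt_le_sqrt h2).trans (le_of_eq ?_)
    rw [← Real.mul_rpow (by norm_num) hlog0.le, Real.sqrt_eq_rpow, ← Real.rpow_natCast,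
      ← Real.rpow_mul (by positivity), Nat.cast_sub hd]
    congr 1
    push_cast
    ring
  have h3 : (n : ℝ)⁻¹ * √(((n : ℝ) ^ (2 * r - 1))⁻¹) = (n : ℝ) ^ (-(r : ℝ) - 1 / 2) := by
    rw [Real.sqrt_eq_rpow, ← Real.rpow_natCast, ← Real.rpow_neg hn0.le, ← Real.rpow_mul hn0.le,
      ← Real.rpow_neg_one, ← Real.rpow_add hn0, Nat.cast_sub (by omega)]
    congr 1
    push_cast
    ring
  have hlog1 : 0 ≤ 1 + Real.log n := by linarith
  rw [Real.sqrt_mul (by positivity), Real.sqrt_mul hC.le]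
  calc 4 / n * (√C * √(((n : ℝ) ^ (2 * r - 1))⁻¹) * √((1 + Real.log n) ^ (d - 1)))
      = 4 * √C * ((n : ℝ)⁻¹ * √(((n : ℝ) ^ (2 * r - 1))⁻¹)) * √((1 + Real.log n) ^ (d - 1)) := by
        rw [div_eq_mul_inv]; ring
    _ ≤ 4 * √C * (n : ℝ) ^ (-(r : ℝ) - 1 / 2) *
        (3 ^ (((d : ℝ) - 1) / 2) * Real.log n ^ (((d : ℝ) - 1) / 2)) := by
        rw [h3]
        gcongr
    _ = _ := by ring

theorem mainTheorem1 (d r : ℕ) (hd : 1 ≤ d) (hr : 1 ≤ r) (B : Matrix (Fin d) (Fin d) ℝ)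
    (hB : IsFrolovMatrix B) :
    ∃ c : ℝ, 0 < c ∧
      ∀ (Ω : Type*) [MeasurableSpace Ω] (P : Measure Ω) [IsProbabilityMeasure P]
        (U : Ω → Fin d → ℝ), pdf.IsUniform U (dilationBox d) P volume →
      ∀ n : ℕ, 2 ≤ n → ∀ v : Fin d → ℝ, ∀ f : EuclideanSpace ℝ (Fin d) → ℝ, MemHMixZero r f →
        Integrable (fun w => |latticeRule (dilatedMatrix n (U w) B) v f - ∫ x, f x|) P ∧
        ∫ w, |latticeRule (dilatedMatrix n (U w) B) v f - ∫ x, f x| ∂P ≤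
          c * (n : ℝ) ^ (-(r : ℝ) - 1 / 2) * Real.log n ^ (((d : ℝ) - 1) / 2) *
            normHMix r (openUnitCube d) f := by
  obtain ⟨C, hC, hCt⟩ := exists_crossTail_le hr (d - 1)
  rw [Nat.sub_add_cancel hd] at hCt
  obtain ⟨hV0, hVt⟩ := volume_dilationBox d
  set V : ℝ := (volume (dilationBox d))⁻¹.toReal with hV
  have hVinv : (volume (dilationBox d))⁻¹ = ENNReal.ofReal V :=
    (ENNReal.ofReal_toReal (ENNReal.inv_ne_top.2 hV0)).symm
  have hVpos : 0 < V :=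
    ENNReal.toReal_pos (ENNReal.inv_ne_zero.2 hVt) (ENNReal.inv_ne_top.2 hV0)
  -- V is the constant density of U on the box; the other factor is the constant of
  -- `sqrt_crossTail_bound`.
  refine ⟨V * (4 * √C * 3 ^ (((d : ℝ) - 1) / 2)), by positivity, ?_⟩
  intro Ω _ P _ U hU n hn v f hf
  have hn0 : n ≠ 0 := by omega
  have hn1 : (1 : ℝ) ≤ n := by exact_mod_cast (by omega : 1 ≤ n)
  have hN : 0 ≤ normHMix r (openUnitCube d) f := Real.sqrt_nonneg _
  have hlog := Real.log_nonneg hn1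
  set G : (Fin d → ℝ) → ℝ := fun u => latticeRule (dilatedMatrix n u B) v f - ∫ x, f x with hG
  have hUm := hU.aemeasurable hV0 hVt
  have hmap : P.map U = ENNReal.ofReal V • volume.restrict (dilationBox d) := by
    rw [← hVinv]
    exact hU
  have hGm : AEMeasurable G (P.map U) := by
    rw [hmap]
    exact ((aemeasurable_latticeRule hn0 hB.invertible v hf.continuous
      hf.hasCompactSupport).sub_const _).smul_measure _
  have hGUm : AEStronglyMeasurable (fun w => G (U w)) P :=
    (hGm.comp_aemeasurable hUm).aestronglyMeasurable
  set R : ℝ := V * (4 * √C * 3 ^ (((d : ℝ) - 1) / 2)) * (n : ℝ) ^ (-(r : ℝ) - 1 / 2) *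
    Real.log n ^ (((d : ℝ) - 1) / 2) * normHMix r (openUnitCube d) f with hR
  have hR0 : 0 ≤ R := by positivity
  have hbound : ∫⁻ w, ‖G (U w)‖ₑ ∂P ≤ ENNReal.ofReal R := by
    rw [← lintegral_map' hGm.enorm hUm, hmap, lintegral_smul_measure, smul_eq_mul]
    refine (mul_le_mul_right (lintegral_dilationBox_error_le hd hn0 hB v hf) _).trans ?_
    refine (mul_le_mul_right (mul_le_mul_right (mul_le_mul_right
      (ENNReal.rpow_le_rpow (hCt n hn1) (by norm_num)) _) _) _).trans ?_
    rw [ENNReal.ofReal_rpow_of_nonneg (by positivity) (by norm_num), ← Real.sqrt_eq_rpow,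
      ← ENNReal.ofReal_mul hN, ← ENNReal.ofReal_mul (by positivity),
      ← ENNReal.ofReal_mul hVpos.le]
    refine ENNReal.ofReal_le_ofReal ?_
    have hs := sqrt_crossTail_bound hd hr hC hn
    calc V * (4 / n * (normHMix r (openUnitCube d) f *
          √(C * ((n : ℝ) ^ (2 * r - 1))⁻¹ * (1 + Real.log n) ^ (d - 1))))
        = V * normHMix r (openUnitCube d) f * (4 / n *
          √(C * ((n : ℝ) ^ (2 * r - 1))⁻¹ * (1 + Real.log n) ^ (d - 1))) := by ring
      _ ≤ V * normHMix r (openUnitCube d) f * (4 * √C * 3 ^ (((d : ℝ) - 1) / 2) *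
          (n : ℝ) ^ (-(r : ℝ) - 1 / 2) * Real.log n ^ (((d : ℝ) - 1) / 2)) := by gcongr
      _ = R := by rw [hR]; ring
  have hint : Integrable (fun w => G (U w)) P :=
    ⟨hGUm, hbound.trans_lt ENNReal.ofReal_lt_top⟩
  refine ⟨hint.abs, ?_⟩
  have h1 : ∫ w, |G (U w)| ∂P = (∫⁻ w, ‖G (U w)‖ₑ ∂P).toReal :=
    integral_norm_eq_lintegral_enorm hGUm
  rw [h1]
  exact ENNReal.toReal_le_of_le_ofReal hR0 hbound
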